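/- Let $\beta>1$ be a quadratic Pisot unit, that is, a real algebraic integer of degree $2$ which is a unit and whose Galois conjugate $\beta'$ satisfies $|\beta'|<1$. Let $\mathcal A$ be a finite set of consecutive integers with $0\in\mathcal A$ and $\#\mathcal A>\beta$, let $\alpha\in\{\beta,-\beta\}$, and let $$X^{\mathcal A}(\alpha)=\Big\{\sum_{i=0}^n a_i\alpha^i : n\in\mathbb N,\ a_i\in\mathcal A\Big\}.$$ Suppose that, for some integers $l\ge 0$ and $j\in\{1,\dots,\lfloor\beta\rfloor\}$, $$\beta^{l-1}(\beta-1)\max\{\beta-j,1\}<\#\mathcal A-1\le\beta^{l-1}(\beta-1)(\beta-j+1).$$ Then the elements of $X^{\mathcal A}(\alpha)$ form a sequence that is strictly monotone in its index: a one-sided increasing sequence $(y_n)_{n\in\mathbb N}$ if $\alpha=\beta$ and $\mathcal A$ has no negative element, a one-sided decreasing sequence $(y_n)_{n\in\mathbb N}$ if $\alpha=\beta$ and $\mathcal A$ has no positive element, and a bidirectional increasing sequence $(y_n)_{n\in\mathbb Z}$ in all other cases. Up to finitely many exceptions, which occur only in the one-sided cases, the distances $|y_{n+1}-y_n|$ between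 consecutive elements take values in the set of the three numbers $$\frac1{\beta^l},\qquad \frac1{\beta^l}(j-\beta'),\qquad \frac1{\beta^l}(j+1-\beta'),$$ and these occur in the sequence of distances with frequencies $$1-\frac{\beta^{l-1}(\beta-1)}{\#\mathcal A-1},\qquad 1-\frac{\beta^{l-1}(\beta-j)(\beta-1)}{\#\mathcal A-1},\qquad -1+\frac{\beta^{l-1}(\beta-j+1)(\beta-1)}{\#\mathcal A-1},$$ respectively. Here the frequency of a value $d$ in a word $u_0u_1u_2\cdots$ is $\lim_{n\to\infty}\frac1n\#\{0\le i<n : u_i=d\}$, and the frequency in a bidirectional word $(u_n)_{n\in\mathbb Z}$ is understood to exist and to have the stated value along both halves $u_0u_1u_2\cdots$ and $u_{-1}u_{-2}u_{-3}\cdots$. -/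

import Mathlib

open Filter Topology

/-- `β` is a quadratic Pisot unit: a real algebraic integer `β > 1` of degree two, invertible in
the ring of algebraic integers, whose other conjugate has modulus less than one. -/
structure IsQuadraticPisotUnit (β : ℝ) : Prop where
  one_lt : 1 < β
  natDegree_minpoly : (minpoly ℚ β).natDegree = 2
  isIntegral : IsIntegral ℤ β
  isIntegral_inv : IsIntegral ℤ β⁻¹
  norm_conj_lt_one : ∀ z : ℂ, IsConjRoot ℚ (β : ℂ) z → z ≠ (β : ℂ) → ‖z‖ < 1

/-- The spectrum of the base `α` over the digit set `A`: all values at `α` of polynomials with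
coefficients in `A`. -/
def digitSpectrum (A : Finset ℤ) (α : ℝ) : Set ℝ :=
  {x | ∃ (n : ℕ) (a : ℕ → ℤ), (∀ i ≤ n, a i ∈ A) ∧
    x = ∑ i ∈ Finset.range (n + 1), (a i : ℝ) * α ^ i}

/-- The value `d` occurs in the one-sided infinite word `u` with (existing) frequency `ρ`. -/
def HasFrequency (u : ℕ → ℝ) (d ρ : ℝ) : Prop :=
  Tendsto (fun n : ℕ => ((Set.ncard {i : ℕ | i < n ∧ u i = d} : ℕ) : ℝ) / (n : ℝ)) atTop (𝓝 ρ)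

/-- The value `d` occurs in the bidirectional infinite word `u` with frequency `ρ`, along its right
half `u 0, u 1, u 2, …` as well as along its left half `u (-1), u (-2), u (-3), …`. -/
def HasTwoSidedFrequency (u : ℤ → ℝ) (d ρ : ℝ) : Prop :=
  HasFrequency (fun n : ℕ => u (n : ℤ)) d ρ ∧ HasFrequency (fun n : ℕ => u (-1 - (n : ℤ))) d ρ

/-! The spectrum is a cut-and-project set. Conjugation on `ℤ[β]` sends `∑ a_i α ^ i` to `∑ a_i γ ^
i` with `γ = ±β'` and `|γ| = 1 / β`, so conjugates of points of the spectrum stay in the window with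
centre `K` and radius `R`, the interval kept invariant by the maps `y ↦ a + γ y`; its length is `2 *
R = (#A - 1) β / (β - 1)`. Conversely, since `β` is a unit, division by `α` preserves `ℤ[β]`, and
since `#A > β` there is always a digit whose removal before the division keeps the conjugate in the
window. Repeated division leads to finitely many points, which are checked by hand. Hence in the
two-sided case every lattice point with conjugate in the open window is in the spectrum
(`mem_digitSpectrum_of_twoSided`); in the one-sided case this holds far out and away from the ends
of the window (`mem_digitSpectrum_of_oneSided`).

The gaps are then those of a three-gap theorem. The hypothesis on `#A - 1` says precisely that the
lattice basis `u = β ^ (-l)`, `w = β ^ (-l) (j - β')` has conjugates of opposite signs, each shorter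
than the window and together at least as long as it (`window_bounds`, `exists_isWindowBasis`). From
a given point the next one is reached by `u`, by `w` or by `u + w`, according to the position of its
conjugate in the window (`IsWindowBasis.gap`).

The three positions form subintervals of the window, and the frequencies are their relative lengths
because the conjugates are equidistributed. Only lower bounds have to be proved, by counting
translates under a lattice vector with tiny conjugate (`eventually_mul_le_card_visits`): the three
lower bounds add up to one, so they are attained (`hasFrequency_of_lower_bounds`). -/

/-! ### Gaps and visits to subintervals in a one-dimensional model set. -/

section CutAndProject

variable {Λ : Type*} [AddCommGroup Λ]

/-- A basis `u, w` of a group `Λ` with a physical projection `f` and an internal projection `g`,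
adapted to windows of length `2 * R`. -/
structure IsWindowBasis (f g : Λ →+ ℝ) (u w : Λ) (R : ℝ) : Prop where
  inj : Function.Injective f
  gen : ∀ v, ∃ a b : ℤ, v = a • u + b • w
  f_u : 0 < f u
  f_w : 0 < f w
  f_ne : f u ≠ f w
  g_u : 0 < g u
  g_w : g w < 0
  lt_u : g u < 2 * R
  lt_w : -g w < 2 * R
  le : 2 * R ≤ g u - g w
  dense : ∀ e : ℝ, 0 < e → ∃ v, 0 < g v ∧ g v < e

/-- A set of lattice points that far out agrees, except near the boundary of the window
`[K - R, K + R]`, with the set of all lattice points whose internal projection is in the window. -/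
structure IsModelSet (f g : Λ →+ ℝ) (T : Set Λ) (K R : ℝ) : Prop where
  bound : ∀ v ∈ T, |g v - K| ≤ R
  diff : ∀ v ∈ T, ∀ v' ∈ T, |g v - g v'| < 2 * R
  eventually_mem : ∀ δ : ℝ, 0 < δ → ∃ M : ℝ, ∀ v, M ≤ f v → |g v - K| ≤ R - δ → v ∈ T

variable {f g : Λ →+ ℝ} {u w : Λ} {K R : ℝ} {T : Set Λ}

/-- Coefficients of opposite signs would move the internal coordinate by at least `g u - g w ≥ 2 *
R`, the length of the window; two nonpositive coefficients would not increase `f`. -/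
theorem IsWindowBasis.exists_nat_combination (h : IsWindowBasis f g u w R) {v v' : Λ}
    (hd : |g v' - g v| < 2 * R) (hf : f v < f v') :
    ∃ a b : ℤ, v' = v + (a • u + b • w) ∧ 0 ≤ a ∧ 0 ≤ b ∧ (1 ≤ a ∨ 1 ≤ b) := by
  obtain ⟨a, b, hab⟩ := h.gen (v' - v)
  have hv : v' = v + (a • u + b • w) := by rw [← hab]; abel
  have h1 : f v' = f v + (a * f u + b * f w) := by rw [hv]; simp
  have h2 : g v' = g v + (a * g u + b * g w) := by rw [hv]; simp
  have h3 := h.f_u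
  have h4 := h.f_w
  have h5 := h.g_u
  have h6 := h.g_w
  have h7 := h.le
  rw [abs_lt] at hd
  have hpos : 0 < a * f u + b * f w := by linarith
  have key : ¬ (a ≤ -1 ∧ 1 ≤ b) ∧ ¬ (1 ≤ a ∧ b ≤ -1) ∧ ¬ (a ≤ 0 ∧ b ≤ 0) := by
    refine ⟨?_, ?_, ?_⟩
    · rintro ⟨ha, hb⟩
      have ha' : (a : ℝ) ≤ -1 := by exact_mod_cast ha
      have hb' : (1 : ℝ) ≤ b := by exact_mod_cast hb
      nlinarith
    · rintro ⟨ha, hb⟩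
      have ha' : (1 : ℝ) ≤ a := by exact_mod_cast ha
      have hb' : (b : ℝ) ≤ -1 := by exact_mod_cast hb
      nlinarith
    · rintro ⟨ha, hb⟩
      have ha' : (a : ℝ) ≤ 0 := by exact_mod_cast ha
      have hb' : (b : ℝ) ≤ 0 := by exact_mod_cast hb
      nlinarith
  exact ⟨a, b, hv, by omega, by omega, by omega⟩

/-- Gaps bounded below are what later turns a bounded shift in value into a bounded shift of the
index. -/
theorem IsWindowBasis.min_le_sub (h : IsWindowBasis f g u w R) {v v' : Λ}
    (hd : |g v' - g v| < 2 * R) (hf : f v < f v') : f v + min (f u) (f w) ≤ f v' := by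
  obtain ⟨a, b, hv, ha, hb, hab⟩ := h.exists_nat_combination hd hf
  have h1 : f v' = f v + (a * f u + b * f w) := by rw [hv]; simp
  have h3 := h.f_u
  have h4 := h.f_w
  have ha' : (0 : ℝ) ≤ a := by exact_mod_cast ha
  have hb' : (0 : ℝ) ≤ b := by exact_mod_cast hb
  rcases hab with h' | h'
  · have h'' : (1 : ℝ) ≤ a := by exact_mod_cast h'
    have := min_le_left (f u) (f w)
    nlinarith
  · have h'' : (1 : ℝ) ≤ b := by exact_mod_cast h'
    have := min_le_right (f u) (f w)
    nlinarith

/-- The gap following a point of a model set. -/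
theorem IsWindowBasis.gap (h : IsWindowBasis f g u w R) {δ : ℝ} (hδ : 0 < δ)
    (hδu : 2 * δ < 2 * R - g u) (hδw : 2 * δ < 2 * R + g w) (hδu' : δ < g u) (hδw' : δ < -g w)
    (hbound : ∀ v ∈ T, |g v - K| ≤ R) (hdiff : ∀ v ∈ T, ∀ v' ∈ T, |g v - g v'| < 2 * R)
    {v v' : Λ} (hT : ∀ x, f v ≤ f x → |g x - K| ≤ R - δ → x ∈ T)
    (hv : v ∈ T) (hv' : v' ∈ T) (hlt : f v < f v')
    (hcons : ∀ x ∈ T, f v < f x → f v' ≤ f x) :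
    (f v' - f v = f u ∨ f v' - f v = f w ∨ f v' - f v = f u + f w) ∧
    (g v + g u ≤ K + R - δ → f v' - f v = f u) ∧
    (K - R + δ ≤ g v + g w → f v' - f v = f w) ∧
    (K + R < g v + g u → g v + g w < K - R → f v' - f v = f u + f w) := by
  have h3 := h.f_u
  have h4 := h.f_w
  have h5 := h.g_u
  have h6 := h.g_w
  have h7 := h.le
  obtain ⟨a, b, hab, ha, hb, hab1⟩ := h.exists_nat_combination (hdiff _ hv' _ hv) hlt
  have e1 : f v' - f v = a * f u + b * f w := by rw [hab]; simp
  have e2 : g v' = g v + (a * g u + b * g w) := by rw [hab]; simp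
  have bv := abs_le.1 (hbound v hv)
  have bv' := abs_le.1 (hbound v' hv')
  have ha' : (0 : ℝ) ≤ a := by exact_mod_cast ha
  have hb' : (0 : ℝ) ≤ b := by exact_mod_cast hb
  -- Here `v + u` is itself in `T`, so the gap is at most `f u`. A step without `u` would lower the
  -- internal coordinate by at least `-g w` and leave the window at the bottom, because `g u - g w ≥
  -- 2 * R`.
  have A : g v + g u ≤ K + R - δ → f v' - f v = f u := by
    intro hA
    have hmem : v + u ∈ T := by
      apply hT
      · simp [h3.le]
      · rw [map_add, abs_le]; constructor <;> linarith
    have hle := hcons _ hmem (by simp [h3])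
    rw [map_add] at hle
    have ha1 : 1 ≤ a := by
      by_contra hcon
      have ha0 : a = 0 := by omega
      have hb1 : (1 : ℝ) ≤ b := by exact_mod_cast (by omega : 1 ≤ b)
      subst ha0
      simp only [Int.cast_zero, zero_mul, zero_add] at e2
      nlinarith
    have ha1' : (1 : ℝ) ≤ a := by exact_mod_cast ha1
    nlinarith
  have B : K - R + δ ≤ g v + g w → f v' - f v = f w := by
    intro hB
    have hmem : v + w ∈ T := by
      apply hT
      · simp [h4.le]
      · rw [map_add, abs_le]; constructor <;> linarith
    have hle := hcons _ hmem (by simp [h4])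
    rw [map_add] at hle
    have hb1 : 1 ≤ b := by
      by_contra hcon
      have hb0 : b = 0 := by omega
      have ha1 : (1 : ℝ) ≤ a := by exact_mod_cast (by omega : 1 ≤ a)
      subst hb0
      simp only [Int.cast_zero, zero_mul, add_zero] at e2
      nlinarith
    have hb1' : (1 : ℝ) ≤ b := by exact_mod_cast hb1
    nlinarith
  refine ⟨?_, A, B, ?_⟩
  -- If both `v + u` and `v + w` are out of the window or within `δ` of its ends, then `v + (u + w)`
  -- is safely inside. It bounds the gap by `f u + f w`, and of the remaining combinations only `u`,
  -- `w` and `u + w` fit.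
  · by_cases hA : g v + g u ≤ K + R - δ
    · exact Or.inl (A hA)
    by_cases hB : K - R + δ ≤ g v + g w
    · exact Or.inr (Or.inl (B hB))
    push Not at hA hB
    have hmem : v + (u + w) ∈ T := by
      apply hT
      · simp only [map_add]; linarith
      · rw [map_add, map_add, abs_le]; constructor <;> linarith
    have hle := hcons _ hmem (by simp only [map_add]; linarith)
    simp only [map_add] at hle
    by_cases ha0 : a = 0
    · subst ha0
      simp only [Int.cast_zero, zero_mul, zero_add] at e1 e2
      have hb1 : b = 1 := by
        by_contra hcon
        have hb2 : (2 : ℝ) ≤ b := by exact_mod_cast (by omega : 2 ≤ b)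
        nlinarith
      right; left; rw [e1, hb1]; simp
    by_cases hb0 : b = 0
    · subst hb0
      simp only [Int.cast_zero, zero_mul, add_zero] at e1 e2
      have ha1 : a = 1 := by
        by_contra hcon
        have ha2 : (2 : ℝ) ≤ a := by exact_mod_cast (by omega : 2 ≤ a)
        nlinarith
      left; rw [e1, ha1]; simp
    have ha1 : (1 : ℝ) ≤ a := by exact_mod_cast (by omega : 1 ≤ a)
    have hb1 : (1 : ℝ) ≤ b := by exact_mod_cast (by omega : 1 ≤ b)
    right; right
    nlinarith
  · intro hA hB
    have hmem : v + (u + w) ∈ T := by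
      apply hT
      · simp only [map_add]; linarith
      · rw [map_add, map_add, abs_le]; constructor <;> linarith
    have hle := hcons _ hmem (by simp only [map_add]; linarith)
    simp only [map_add] at hle
    have hb1 : 1 ≤ b := by
      by_contra hcon
      have hb0 : b = 0 := by omega
      have ha1 : (1 : ℝ) ≤ a := by exact_mod_cast (by omega : 1 ≤ a)
      subst hb0
      simp only [Int.cast_zero, zero_mul, add_zero] at e2
      nlinarith
    have ha1 : 1 ≤ a := by
      by_contra hcon
      have ha0 : a = 0 := by omega
      have hb1 : (1 : ℝ) ≤ b := by exact_mod_cast (by omega : 1 ≤ b)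
      subst ha0
      simp only [Int.cast_zero, zero_mul, zero_add] at e2
      nlinarith
    have ha1 : (1 : ℝ) ≤ a := by exact_mod_cast ha1
    have hb1 : (1 : ℝ) ≤ b := by exact_mod_cast hb1
    nlinarith

/-- Lower bound for the frequency of the visits of the internal projection to an interval, by
double counting of the pairs `(i, k)` with `z i + k • e` in the interval. -/
theorem eventually_mul_le_card_visits
    (hdense : ∀ e : ℝ, 0 < e → ∃ v, 0 < g v ∧ g v < e)
    {z : ℕ → Λ} {c d a b η : ℝ} {i₀ : ℕ} (hcd : c < d) (hη : 0 < η)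
    (hz : StrictMono fun i => f (z i)) (htop : Tendsto (fun i => f (z i)) atTop atTop)
    (hwin : ∀ i ≥ i₀, c ≤ g (z i) ∧ g (z i) ≤ d)
    (hgap : ∀ i ≥ i₀, f (z i) + η ≤ f (z (i + 1)))
    (hac : c ≤ a) (hbd : b ≤ d)
    {M : ℝ} (hM : ∀ v, M ≤ f v → a ≤ g v → g v ≤ b → ∃ i, z i = v)
    {r : ℝ} (hr : r < (b - a) / (d - c)) :
    ∀ᶠ n : ℕ in atTop,
      r * n ≤ (((Finset.range n).filter fun i => a ≤ g (z i) ∧ g (z i) ≤ b).card : ℝ) := by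
  have hzinj : Function.Injective z := fun i j hij => hz.injective (by simp [hij])
  have hlen : 0 < d - c := by linarith
  -- the translation
  obtain ⟨e₀, he₀, hre⟩ : ∃ e₀ : ℝ, 0 < e₀ ∧ ∀ e : ℝ, 0 < e → e < e₀ →
      r < (b - a - e) / (d - c + e) := by
    have hcont : ContinuousAt (fun e : ℝ => (b - a - e) / (d - c + e)) 0 := by
      apply ContinuousAt.div (by fun_prop) (by fun_prop)
      simpa using hlen.ne'
    have := hcont.eventually_const_lt (u := r) (by simpa using hr)
    obtain ⟨e₀, h1, h2⟩ := Metric.eventually_nhds_iff.1 this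
    refine ⟨e₀, h1, fun e h3 h4 => h2 ?_⟩
    rw [Real.dist_eq, sub_zero, abs_of_pos h3]; exact h4
  obtain ⟨w, hw, hwe⟩ := hdense e₀ he₀
  set e := g w with he
  have hre := hre e hw hwe
  set r' := (b - a - e) / (d - c + e) with hr'
  have hden : 0 < d - c + e := by linarith
  -- the bound on the multiples of the translation
  set B : ℝ := (d - c) / e * |f w| with hB
  have hB0 : 0 ≤ B := by positivity
  obtain ⟨C, hC⟩ := exists_nat_ge (B / η)
  obtain ⟨i₁, hi₁⟩ : ∃ i₁, ∀ i ≥ i₁, M + B ≤ f (z i) := by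
    simpa using (htop.eventually_ge_atTop (M + B))
  set i₂ := max i₀ i₁ with hi₂
  have hgrow : ∀ i ≥ i₀, ∀ p : ℕ, f (z i) + p * η ≤ f (z (i + p)) := by
    intro i hi p
    induction p with
    | zero => simp
    | succ p ih =>
      have := hgap (i + p) (by omega)
      push_cast
      rw [← add_assoc]
      linarith
  -- translates of a point that visit the interval
  have hex : ∀ i ≥ i₂, ∀ k : ℤ, a ≤ g (z i) + k * e → g (z i) + k * e ≤ b →
      ∃ i', z i' = z i + k • w ∧ i' ≤ i + C := by
    -- Both points have internal coordinate in `[c, d]`, so `|k| ≤ (d - c) / e` and the value moves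
    -- by at most `B`; gaps of at least `η` bound the advance of the index by `C`.
    intro i hi k h1 h2
    have hi0 : i ≥ i₀ := le_trans (le_max_left _ _) hi
    have hi1 : i ≥ i₁ := le_trans (le_max_right _ _) hi
    have hwi := hwin i hi0
    have hk : |(k : ℝ)| ≤ (d - c) / e := by
      have h3 : |(k : ℝ)| * e = |k * e| := by rw [abs_mul, abs_of_pos hw]
      rw [le_div_iff₀ hw, h3, abs_le]
      constructor <;> linarith
    have hkf : |(k : ℝ) * f w| ≤ B := by
      rw [abs_mul]; exact mul_le_mul_of_nonneg_right hk (abs_nonneg _)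
    have hfe : f (z i + k • w) = f (z i) + k * f w := by simp
    have hge : g (z i + k • w) = g (z i) + k * e := by simp [he]
    obtain ⟨i', hi'⟩ := hM (z i + k • w) (by
      rw [hfe]; have := hi₁ i hi1; have := (abs_le.1 hkf).1; linarith)
      (by rw [hge]; exact h1) (by rw [hge]; exact h2)
    refine ⟨i', hi', ?_⟩
    by_contra hcon
    push Not at hcon
    have h3 := hgrow i hi0 (i' - i)
    rw [Nat.add_sub_cancel' (by omega), hi', hfe] at h3
    have h4 : ((C + 1 : ℕ) : ℝ) ≤ ((i' - i : ℕ) : ℝ) := by exact_mod_cast (by omega)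
    have h5 := (abs_le.1 hkf).2
    have h6 : B ≤ C * η := by rwa [div_le_iff₀ hη] at hC
    push_cast at h4
    nlinarith
  choose! φ hφ hφC using hex
  let I : ℕ → Finset ℤ := fun i => Finset.Icc ⌈(a - g (z i)) / e⌉ ⌊(b - g (z i)) / e⌋
  let J : ℕ → Finset ℤ := fun i => Finset.Icc ⌈(g (z i) - d) / e⌉ ⌊(g (z i) - c) / e⌋
  have hI : ∀ i k, k ∈ I i ↔ a ≤ g (z i) + k * e ∧ g (z i) + k * e ≤ b := by
    intro i k
    simp only [I, Finset.mem_Icc, Int.ceil_le, Int.le_floor]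
    rw [div_le_iff₀ hw, le_div_iff₀ hw]
    constructor <;> rintro ⟨h1, h2⟩ <;> constructor <;> linarith
  have hJ : ∀ i k, k ∈ J i ↔ c ≤ g (z i) - k * e ∧ g (z i) - k * e ≤ d := by
    intro i k
    simp only [J, Finset.mem_Icc, Int.ceil_le, Int.le_floor]
    rw [div_le_iff₀ hw, le_div_iff₀ hw]
    constructor <;> rintro ⟨h1, h2⟩ <;> constructor <;> linarith
  have hIcard : ∀ i, (b - a) / e - 1 ≤ ((I i).card : ℝ) := by
    intro i
    simp only [I, Int.card_Icc]
    have h1 := Int.ceil_lt_add_one ((a - g (z i)) / e)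
    have h2 := Int.lt_floor_add_one ((b - g (z i)) / e)
    have h3 : ((⌊(b - g (z i)) / e⌋ + 1 - ⌈(a - g (z i)) / e⌉ : ℤ) : ℝ) ≤
        ((⌊(b - g (z i)) / e⌋ + 1 - ⌈(a - g (z i)) / e⌉).toNat : ℝ) := by
      exact_mod_cast Int.self_le_toNat _
    push_cast at h3
    have h4 : (b - g (z i)) / e - (a - g (z i)) / e = (b - a) / e := by ring
    linarith
  have hJcard : ∀ i, ((J i).card : ℝ) ≤ (d - c) / e + 1 := by
    intro i
    simp only [J, Int.card_Icc]
    have h1 := Int.le_ceil ((g (z i) - d) / e)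
    have h2 := Int.floor_le ((g (z i) - c) / e)
    have h4 : (g (z i) - c) / e - (g (z i) - d) / e = (d - c) / e := by ring
    rcases le_total 0 (⌊(g (z i) - c) / e⌋ + 1 - ⌈(g (z i) - d) / e⌉) with h0 | h0
    · have h3 : ((⌊(g (z i) - c) / e⌋ + 1 - ⌈(g (z i) - d) / e⌉ : ℤ) : ℝ) =
          ((⌊(g (z i) - c) / e⌋ + 1 - ⌈(g (z i) - d) / e⌉).toNat : ℝ) := by
        exact_mod_cast (Int.toNat_of_nonneg h0).symm
      rw [← h3]
      push_cast
      linarith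
    · rw [Int.toNat_of_nonpos h0]
      have : 0 ≤ (d - c) / e := by positivity
      simp only [Nat.cast_zero]; linarith
  let V : ℕ → Finset ℕ := fun n => (Finset.range n).filter fun i => a ≤ g (z i) ∧ g (z i) ≤ b
  have hcount : ∀ n, i₂ ≤ n →
      ((n : ℝ) - i₂) * ((b - a) / e - 1) ≤ (((V n).card : ℝ) + C) * ((d - c) / e + 1) := by
    intro n hn
    have hle : ((Finset.Ico i₂ n).sigma I).card ≤ ((V (n + C)).sigma J).card := by
      -- Each `i` has at least `(b - a) / e - 1` translates in the interval, and each visit comes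
      -- from at most `(d - c) / e + 1` pairs. Keeping `k` in the image makes the map injective.
      apply Finset.card_le_card_of_injOn (fun x => ⟨φ x.1 x.2, x.2⟩)
      · rintro ⟨i, k⟩ hx
        simp only [Finset.coe_sigma, Set.mem_sigma_iff, Finset.coe_Ico, Set.mem_Ico,
          Finset.mem_coe] at hx
        obtain ⟨⟨hi1, hi2⟩, hk⟩ := hx
        have hk' := (hI i k).1 hk
        have h1 := hφ i hi1 k hk'.1 hk'.2
        have h2 := hφC i hi1 k hk'.1 hk'.2
        have hge : g (z (φ i k)) = g (z i) + k * e := by rw [h1]; simp [he]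
        have hwi := hwin i (le_trans (le_max_left _ _) hi1)
        simp only [Finset.coe_sigma, Set.mem_sigma_iff, Finset.mem_coe]
        refine ⟨?_, ?_⟩
        · simp only [V, Finset.mem_filter, Finset.mem_range]
          refine ⟨by omega, ?_⟩
          rw [hge]; exact hk'
        · rw [hJ, hge]
          constructor <;> linarith [hwi.1, hwi.2]
      · rintro ⟨i, k⟩ hx ⟨i', k'⟩ hx' hxx
        simp only [Finset.coe_sigma, Set.mem_sigma_iff, Finset.coe_Ico, Set.mem_Ico,
          Finset.mem_coe] at hx hx'
        simp only [Sigma.mk.injEq, heq_eq_eq] at hxx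
        obtain ⟨h0, rfl⟩ := hxx
        have hk := (hI i k).1 hx.2
        have hk' := (hI i' k).1 hx'.2
        have h1 := hφ i hx.1.1 k hk.1 hk.2
        have h2 := hφ i' hx'.1.1 k hk'.1 hk'.2
        rw [h0, h2] at h1
        have := hzinj (add_right_cancel h1)
        rw [this]
    rw [Finset.card_sigma, Finset.card_sigma] at hle
    have hle' : (∑ i ∈ Finset.Ico i₂ n, ((I i).card : ℝ)) ≤
        ∑ i ∈ V (n + C), ((J i).card : ℝ) := by exact_mod_cast hle
    have h1 : ((n : ℝ) - i₂) * ((b - a) / e - 1) ≤ ∑ i ∈ Finset.Ico i₂ n, ((I i).card : ℝ) := by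
      have := Finset.card_nsmul_le_sum (Finset.Ico i₂ n) (fun i => ((I i).card : ℝ))
        ((b - a) / e - 1) (fun i _ => hIcard i)
      rwa [nsmul_eq_mul, Nat.card_Ico, Nat.cast_sub hn] at this
    have h2 : (∑ i ∈ V (n + C), ((J i).card : ℝ)) ≤
        ((V (n + C)).card : ℝ) * ((d - c) / e + 1) := by
      have := Finset.sum_le_card_nsmul (V (n + C)) (fun i => ((J i).card : ℝ))
        ((d - c) / e + 1) (fun i _ => hJcard i)
      rwa [nsmul_eq_mul] at this
    have h3 : (V (n + C)).card ≤ (V n).card + C := by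
      have hsub : V (n + C) ⊆ V n ∪ Finset.Ico n (n + C) := by
        intro i hi
        simp only [V, Finset.mem_filter, Finset.mem_range, Finset.mem_union,
          Finset.mem_Ico] at hi ⊢
        by_cases h : i < n
        · exact Or.inl ⟨h, hi.2⟩
        · exact Or.inr ⟨by omega, hi.1⟩
      have := (Finset.card_le_card hsub).trans (Finset.card_union_le _ _)
      simpa using this
    have h3' : ((V (n + C)).card : ℝ) ≤ (V n).card + C := by exact_mod_cast h3
    have h4 : 0 < (d - c) / e + 1 := by positivity
    calc _ ≤ _ := h1
      _ ≤ _ := hle'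
      _ ≤ _ := h2
      _ ≤ _ := mul_le_mul_of_nonneg_right h3' h4.le
  have hcount' : ∀ n, i₂ ≤ n → ((n : ℝ) - i₂) * r' - C ≤ ((V n).card : ℝ) := by
    intro n hn
    have h1 := hcount n hn
    have h2 : (b - a) / e - 1 = r' * ((d - c) / e + 1) := by
      rw [hr']; field_simp
    rw [h2, ← mul_assoc] at h1
    have h4 : 0 < (d - c) / e + 1 := by positivity
    have := le_of_mul_le_mul_right h1 h4
    linarith
  obtain ⟨n₀, hn₀⟩ := exists_nat_ge ((i₂ * r' + C) / (r' - r))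
  filter_upwards [eventually_ge_atTop (max i₂ n₀)] with n hn
  have h1 := hcount' n (le_trans (le_max_left _ _) hn)
  have h2 : (n₀ : ℝ) ≤ n := by exact_mod_cast le_trans (le_max_right _ _) hn
  have h3 : i₂ * r' + C ≤ n * (r' - r) := by
    rw [← div_le_iff₀ (by linarith)]; linarith
  change r * n ≤ ((V n).card : ℝ)
  nlinarith

end CutAndProject

/-! ### Frequencies from asymptotic lower bounds. -/

theorem ncard_lt_and_eq (U : ℕ → ℝ) (d : ℝ) (n : ℕ) :
    Set.ncard {i : ℕ | i < n ∧ U i = d} =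
      ((Finset.range n).filter fun i => U i = d).card := by
  rw [← Set.ncard_coe_finset]
  congr 1
  ext i
  simp

/-- Three asymptotic lower bounds with total mass one for the frequencies of three distinct letters
are attained. -/
theorem hasFrequency_of_lower_bounds {U : ℕ → ℝ} {D ρ : Fin 3 → ℝ} (hD : Function.Injective D)
    (hρ : ∑ k, ρ k = 1)
    (hlow : ∀ k, ∀ r < ρ k, ∀ᶠ n : ℕ in atTop,
      r * n ≤ (((Finset.range n).filter fun i => U i = D k).card : ℝ)) (k : Fin 3) :
    HasFrequency U (D k) (ρ k) := by
  unfold HasFrequency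
  simp_rw [ncard_lt_and_eq]
  rw [Metric.tendsto_atTop']
  intro e he
  have h := eventually_all.2 fun k => hlow k (ρ k - e / 3) (by linarith)
  obtain ⟨N, hN⟩ := eventually_atTop.1 h
  refine ⟨N, fun n hn => ?_⟩
  have hn0 : (0 : ℝ) < n := by exact_mod_cast (by omega : 0 < n)
  have hlow' := hN n hn.le
  have hsum : ∑ k, ((Finset.range n).filter fun i => U i = D k).card ≤ n := by
    rw [← Finset.card_biUnion]
    · calc _ ≤ (Finset.range n).card := Finset.card_le_card (by
            intro i hi
            simp only [Finset.mem_biUnion, Finset.mem_filter] at hi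
            obtain ⟨_, _, hi, _⟩ := hi
            exact hi)
        _ = n := Finset.card_range n
    · intro a _ b _ hab
      rw [Function.onFun, Finset.disjoint_left]
      intro i hi hi'
      simp only [Finset.mem_filter] at hi hi'
      exact hab (hD (hi.2.symm.trans hi'.2))
  have hsum' : ∑ k, (((Finset.range n).filter fun i => U i = D k).card : ℝ) ≤ n := by
    exact_mod_cast hsum
  rw [Real.dist_eq, abs_lt]
  have hdiv : ∀ x : ℝ, x / n * n = x := fun x => div_mul_cancel₀ x hn0.ne'
  constructor
  · have := hlow' k
    rw [← le_div_iff₀ hn0] at this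
    linarith
  -- The upper bound for one letter is what the other two leave over; each of them may fall short by
  -- `e / 3`.
  · rw [sub_lt_iff_lt_add, div_lt_iff₀ hn0]
    rw [Fin.sum_univ_three] at hsum' hρ
    have h0 := hlow' 0
    have h1 := hlow' 1
    have h2 := hlow' 2
    fin_cases k <;> simp only [Fin.zero_eta, Fin.mk_one, Fin.reduceFinMk] <;> nlinarith

/-! ### Frequencies of the gaps in a model set. -/

section CutAndProject

variable {Λ : Type*} [AddCommGroup Λ] {f g : Λ →+ ℝ} {u w : Λ} {K R : ℝ} {T : Set Λ}

/-- The first `i₀` indices, where visits need not produce the letter, are paid for by the slack `r₁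
- r`. -/
theorem eventually_mul_le_card_of_visits {U V : ℕ → ℝ} {D a b r₁ r : ℝ} {i₀ : ℕ} (hr : r < r₁)
    (hlow : ∀ᶠ n : ℕ in atTop,
      r₁ * n ≤ (((Finset.range n).filter fun i => a ≤ V i ∧ V i ≤ b).card : ℝ))
    (hUV : ∀ i ≥ i₀, a ≤ V i → V i ≤ b → U i = D) :
    ∀ᶠ n : ℕ in atTop, r * n ≤ (((Finset.range n).filter fun i => U i = D).card : ℝ) := by
  obtain ⟨n₀, hn₀⟩ := exists_nat_ge (i₀ / (r₁ - r))
  filter_upwards [hlow, eventually_ge_atTop n₀] with n h1 h2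
  have h3 : ((Finset.range n).filter fun i => a ≤ V i ∧ V i ≤ b).card ≤
      ((Finset.range n).filter fun i => U i = D).card + i₀ := by
    have hsub : ((Finset.range n).filter fun i => a ≤ V i ∧ V i ≤ b) ⊆
        ((Finset.range n).filter fun i => U i = D) ∪ Finset.range i₀ := by
      intro i hi
      simp only [Finset.mem_filter, Finset.mem_range, Finset.mem_union] at hi ⊢
      by_cases h : i < i₀
      · exact Or.inr h
      · exact Or.inl ⟨hi.1, hUV i (by omega) hi.2.1 hi.2.2⟩
    have := (Finset.card_le_card hsub).trans (Finset.card_union_le _ _)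
    simpa using this
  have h3' : (((Finset.range n).filter fun i => a ≤ V i ∧ V i ≤ b).card : ℝ) ≤
      ((Finset.range n).filter fun i => U i = D).card + i₀ := by exact_mod_cast h3
  have h4 : (n₀ : ℝ) ≤ n := by exact_mod_cast h2
  have h5 : i₀ ≤ n * (r₁ - r) := by
    rw [← div_le_iff₀ (by linarith)]; linarith
  nlinarith

/-- The gaps between consecutive points of a model set, and their frequencies. -/
theorem IsWindowBasis.hasFrequency_gap (h : IsWindowBasis f g u w R) (hT : IsModelSet f g T K R)
    {y : ℕ → ℝ} (hy : StrictMono y) (hyT : ∀ n, ∃ v ∈ T, f v = y n)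
    (hTy : ∀ v ∈ T, y 0 ≤ f v → ∃ n, y n = f v) (htop : Tendsto y atTop atTop) :
    {n : ℕ | y (n + 1) - y n ∉ Set.range ![f u, f w, f u + f w]}.Finite ∧
    ∀ k : Fin 3, HasFrequency (fun n => y (n + 1) - y n) (![f u, f w, f u + f w] k)
      (![1 - g u / (2 * R), 1 + g w / (2 * R), (g u - g w) / (2 * R) - 1] k) := by
  choose z hzT hzy using hyT
  have h1 := h.f_u
  have h2 := h.f_w
  have h3 := h.g_u
  have h4 := h.g_w
  have h5 := h.lt_u
  have h6 := h.lt_w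
  have h7 := h.le
  have hR : 0 < 2 * R := by linarith
  have hz : StrictMono fun i => f (z i) := by simpa only [hzy] using hy
  have hztop : Tendsto (fun i => f (z i)) atTop atTop := by simpa only [hzy] using htop
  have hwin : ∀ i, K - R ≤ g (z i) ∧ g (z i) ≤ K + R := by
    intro i
    have := abs_le.1 (hT.bound _ (hzT i))
    constructor <;> linarith
  have hcons : ∀ i, ∀ x ∈ T, f (z i) < f x → f (z (i + 1)) ≤ f x := by
    intro i x hx hlt
    obtain ⟨n, hn⟩ := hTy x hx (by
      rw [hzy] at hlt
      exact (hy.monotone (Nat.zero_le i)).trans hlt.le)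
    rw [← hn, hzy] at hlt ⊢
    rw [hy.lt_iff_lt] at hlt
    exact hy.monotone hlt
  have hgap : ∀ i, f (z i) + min (f u) (f w) ≤ f (z (i + 1)) := fun i =>
    h.min_le_sub (hT.diff _ (hzT _) _ (hzT _)) (hz (Nat.lt_succ_self i))
  have hlocal : ∀ δ : ℝ, 0 < δ → 2 * δ < 2 * R - g u → 2 * δ < 2 * R + g w → δ < g u →
      δ < -g w → ∃ i₀, ∀ i ≥ i₀,
    (y (i + 1) - y i = f u ∨ y (i + 1) - y i = f w ∨ y (i + 1) - y i = f u + f w) ∧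
    (g (z i) + g u ≤ K + R - δ → y (i + 1) - y i = f u) ∧
    (K - R + δ ≤ g (z i) + g w → y (i + 1) - y i = f w) ∧
    (K + R < g (z i) + g u → g (z i) + g w < K - R → y (i + 1) - y i = f u + f w) := by
    intro δ hδ hδu hδw hδu' hδw'
    obtain ⟨M, hM⟩ := hT.eventually_mem δ hδ
    obtain ⟨i₀, hi₀⟩ : ∃ i₀, ∀ i ≥ i₀, M ≤ f (z i) := by
      simpa using (hztop.eventually_ge_atTop M)
    refine ⟨i₀, fun i hi => ?_⟩
    have := h.gap hδ hδu hδw hδu' hδw' hT.bound hT.diff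
      (fun x hx hx' => hM x ((hi₀ i hi).trans hx) hx') (hzT i) (hzT (i + 1))
      (hz (Nat.lt_succ_self i)) (hcons i)
    simpa only [hzy] using this
  -- all small enough margins
  obtain ⟨δ₀, hδ₀, hδ₀1, hδ₀2, hδ₀3, hδ₀4⟩ : ∃ δ₀ : ℝ, 0 < δ₀ ∧ 2 * δ₀ < 2 * R - g u ∧
      2 * δ₀ < 2 * R + g w ∧ δ₀ < g u ∧ δ₀ < -g w := by
    refine ⟨min (min (2 * R - g u) (2 * R + g w)) (min (g u) (-g w)) / 4, ?_, ?_, ?_, ?_, ?_⟩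
    · have : 0 < min (min (2 * R - g u) (2 * R + g w)) (min (g u) (-g w)) := by
        simp only [lt_min_iff]
        refine ⟨⟨?_, ?_⟩, ?_, ?_⟩ <;> linarith
      linarith
    all_goals
      have a1 := min_le_left (min (2 * R - g u) (2 * R + g w)) (min (g u) (-g w))
      have a2 := min_le_right (min (2 * R - g u) (2 * R + g w)) (min (g u) (-g w))
      have a3 := min_le_left (2 * R - g u) (2 * R + g w)
      have a4 := min_le_right (2 * R - g u) (2 * R + g w)
      have a5 := min_le_left (g u) (-g w)
      have a6 := min_le_right (g u) (-g w)
      linarith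
  have hvisit : ∀ δ a b r : ℝ, 0 < δ → K - R + δ ≤ a → b ≤ K + R - δ →
      r < (b - a) / (2 * R) → ∀ᶠ n : ℕ in atTop,
      r * n ≤ (((Finset.range n).filter fun i => a ≤ g (z i) ∧ g (z i) ≤ b).card : ℝ) := by
    intro δ a b r hδ ha hb hr
    obtain ⟨M, hM⟩ := hT.eventually_mem δ hδ
    refine eventually_mul_le_card_visits (c := K - R) (d := K + R) (i₀ := 0)
      (M := max M (y 0)) (η := min (f u) (f w)) h.dense (by linarith) (lt_min h1 h2) hz hztop
      (fun i _ => hwin i) (fun i _ => hgap i) (by linarith) (by linarith) ?_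
      (by convert hr using 2; ring)
    intro v hv1 hv2 hv3
    have hvT := hM v ((le_max_left _ _).trans hv1) (by rw [abs_le]; constructor <;> linarith)
    obtain ⟨n, hn⟩ := hTy v hvT ((le_max_right _ _).trans hv1)
    exact ⟨n, h.inj (by rw [hzy, hn])⟩
  constructor
  · obtain ⟨i₀, hi₀⟩ := hlocal δ₀ hδ₀ hδ₀1 hδ₀2 hδ₀3 hδ₀4
    refine (Set.finite_lt_nat i₀).subset fun n hn => ?_
    by_contra hcon
    apply hn
    simp only [Set.mem_ofPred_eq, not_lt] at hcon
    rcases (hi₀ n hcon).1 with h' | h' | h'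
    · exact ⟨0, h'.symm⟩
    · exact ⟨1, h'.symm⟩
    · exact ⟨2, h'.symm⟩
  · apply hasFrequency_of_lower_bounds
    · intro a b hab
      have := h.f_ne
      fin_cases a <;> fin_cases b <;> simp at hab ⊢ <;>
        first | exact this hab | exact this hab.symm | linarith
    · rw [Fin.sum_univ_three]
      simp only [Matrix.cons_val_zero, Matrix.cons_val_one, Matrix.cons_val]
      ring
    -- The cut points `K + R - g u ≤ K - R - g w` divide the window into three pieces, on which the
    -- gap is `f u`, `f u + f w` and `f w` from bottom to top. Each piece is shrunk by `δ` at both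
    -- ends, and `δ` is chosen so small that the loss in frequency stays above `r`.
    · have main : ∀ (D lo hi L : ℝ), (∀ δ : ℝ, 0 < δ → δ ≤ δ₀ → K - R + δ ≤ lo + δ ∧
          hi - δ ≤ K + R - δ) → hi - lo = L →
          (∀ δ : ℝ, 0 < δ → δ ≤ δ₀ → ∃ i₀, ∀ i ≥ i₀, lo + δ ≤ g (z i) →
            g (z i) ≤ hi - δ → y (i + 1) - y i = D) →
          ∀ r < L / (2 * R), ∀ᶠ n : ℕ in atTop,
          r * n ≤ (((Finset.range n).filter fun i => y (i + 1) - y i = D).card : ℝ) := by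
        intro D lo hi L hin hL hloc r hr
        rw [lt_div_iff₀ hR] at hr
        set δ := min δ₀ ((L - r * (2 * R)) / 4) with hδdef
        have hδpos : 0 < δ := lt_min hδ₀ (by linarith)
        have hδle : δ ≤ (L - r * (2 * R)) / 4 := min_le_right _ _
        obtain ⟨i₀, hi₀⟩ := hloc δ hδpos (min_le_left _ _)
        obtain ⟨hin1, hin2⟩ := hin δ hδpos (min_le_left _ _)
        obtain ⟨r₁, hr1, hr2⟩ := exists_between
          (show r < (hi - δ - (lo + δ)) / (2 * R) by
            rw [lt_div_iff₀ hR]; linarith)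
        exact eventually_mul_le_card_of_visits hr1 (hvisit δ _ _ r₁ hδpos hin1 hin2 hr2) hi₀
      have hlocal' : ∀ δ : ℝ, 0 < δ → δ ≤ δ₀ → _ := fun δ hδ hle =>
        hlocal δ hδ (by linarith) (by linarith) (by linarith) (by linarith)
      intro k
      fin_cases k
      · intro r hr
        refine main (f u) (K - R) (K + R - g u) (2 * R - g u) ?_ (by ring) ?_ r ?_
        · intro δ hδ hle; constructor <;> linarith
        · intro δ hδ hle
          obtain ⟨i₀, hi₀⟩ := hlocal' δ hδ hle
          exact ⟨i₀, fun i hi _ h' => (hi₀ i hi).2.1 (by linarith)⟩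
        · have : (2 * R - g u) / (2 * R) = 1 - g u / (2 * R) := by
            rw [sub_div, div_self hR.ne']
          rw [this]; exact hr
      · intro r hr
        refine main (f w) (K - R - g w) (K + R) (2 * R + g w) ?_ (by ring) ?_ r ?_
        · intro δ hδ hle; constructor <;> linarith
        · intro δ hδ hle
          obtain ⟨i₀, hi₀⟩ := hlocal' δ hδ hle
          exact ⟨i₀, fun i hi h' _ => (hi₀ i hi).2.2.1 (by linarith)⟩
        · have : (2 * R + g w) / (2 * R) = 1 + g w / (2 * R) := by
            rw [add_div, div_self hR.ne']
          rw [this]; exact hr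
      · intro r hr
        refine main (f u + f w) (K + R - g u) (K - R - g w) (g u - g w - 2 * R) ?_ (by ring) ?_ r ?_
        · intro δ hδ hle; constructor <;> linarith
        · intro δ hδ hle
          obtain ⟨i₀, hi₀⟩ := hlocal' δ hδ hle
          exact ⟨i₀, fun i hi h1 h2 => (hi₀ i hi).2.2.2 (by linarith) (by linarith)⟩
        · have : (g u - g w - 2 * R) / (2 * R) = (g u - g w) / (2 * R) - 1 := by
            rw [sub_div, div_self hR.ne']
          rw [this]; exact hr

end CutAndProject

/-! ### The lattice `ℤ[β]` and its conjugation. -/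

/-- The value `p + q θ` of a pair of integers. -/
noncomputable def latticeValue (θ : ℝ) : ℤ × ℤ →+ ℝ where
  toFun v := v.1 + v.2 * θ
  map_zero' := by simp
  map_add' v w := by simp; ring

theorem latticeValue_apply (θ : ℝ) (v : ℤ × ℤ) : latticeValue θ v = v.1 + v.2 * θ := rfl

/-- `β` and `β'` are the larger and the smaller root of `X ^ 2 - m X + ε`, with `ε = ±1`. -/
structure IsQuadraticUnitPair (β β' : ℝ) (m ε : ℤ) : Prop where
  one_lt : 1 < β
  sign : ε = 1 ∨ ε = -1
  add_eq : β + β' = m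
  mul_eq : β * β' = ε
  irrational : Irrational β

/-- Vieta's formulas for the integral minimal polynomial give trace and norm. The inverse of the
norm is `β⁻¹ * β'⁻¹`, a rational algebraic integer, hence an integer, so the norm is `±1`. -/
theorem IsQuadraticPisotUnit.exists_isQuadraticUnitPair {β β' : ℝ} (hβ : IsQuadraticPisotUnit β)
    (hβ' : IsConjRoot ℚ β β') (hne : β' ≠ β) : ∃ m ε : ℤ, IsQuadraticUnitPair β β' m ε := by
  have hmin := minpoly.isIntegrallyClosed_eq_field_fractions' ℚ hβ.isIntegral
  have hmonic := minpoly.monic hβ.isIntegral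
  have hdeg : (minpoly ℤ β).natDegree = 2 := by
    have h := hβ.natDegree_minpoly
    rwa [hmin, hmonic.natDegree_map] at h
  set P := minpoly ℤ β with hP
  have hβ0 : β ≠ 0 := by have := hβ.one_lt; linarith
  have heval : ∀ x : ℝ, Polynomial.aeval x (minpoly ℚ β) = x ^ 2 + P.coeff 1 * x + P.coeff 0 := by
    intro x
    rw [hmin, Polynomial.aeval_map_algebraMap, Polynomial.aeval_eq_sum_range, hdeg]
    have h2 : P.coeff 2 = 1 := by rw [← hdeg]; exact hmonic.coeff_natDegree
    simp [Finset.sum_range_succ, h2]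
    ring
  have e1 : β ^ 2 + P.coeff 1 * β + P.coeff 0 = 0 := by
    rw [← heval, minpoly.aeval]
  have e2 : β' ^ 2 + P.coeff 1 * β' + P.coeff 0 = 0 := by
    rw [← heval, hβ', minpoly.aeval]
  have hadd : β + β' = ((-P.coeff 1 : ℤ) : ℝ) := by
    have h : (β' - β) * (β + β' + P.coeff 1) = 0 := by linear_combination e2 - e1
    rcases mul_eq_zero.1 h with h | h
    · exact absurd (sub_eq_zero.1 h) hne
    · push_cast; linarith
  have hmul : β * β' = ((P.coeff 0 : ℤ) : ℝ) := by
    push_cast at hadd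
    linear_combination (-1 : ℝ) * e1 + β * hadd
  have hirr : Irrational β := by
    rintro ⟨q, hq⟩
    have h := hβ.natDegree_minpoly
    rw [← hq, show ((q : ℝ)) = algebraMap ℚ ℝ q from rfl, minpoly.eq_X_sub_C,
      Polynomial.natDegree_X_sub_C] at h
    omega
  have hβ'0 : β' ≠ 0 := by
    rintro h0
    rw [h0, add_zero] at hadd
    exact hirr ⟨((-P.coeff 1 : ℤ) : ℚ), by rw [hadd]; simp⟩
  -- The reverse of a monic integral equation `G` of `β⁻¹` vanishes at `β`, is therefore divisible
  -- by the minimal polynomial, and so vanishes at `β'`; reversing back shows that `G` vanishes at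
  -- `β'⁻¹`.
  have hinv' : IsIntegral ℤ β'⁻¹ := by
    obtain ⟨G, hG, hG0⟩ := hβ.isIntegral_inv
    refine ⟨G, hG, ?_⟩
    let _ := invertibleOfNonzero hβ0
    let _ := invertibleOfNonzero hβ'0
    rw [← invOf_eq_inv] at hG0 ⊢
    have hG1 : Polynomial.eval₂ (algebraMap ℤ ℝ) β G.reverse = 0 := by
      let _ := invertibleInvOf (a := β)
      have := (Polynomial.eval₂_reverse_eq_zero_iff (algebraMap ℤ ℝ) (⅟β) G).2 hG0
      simpa using this
    have hdvd : minpoly ℚ β ∣ G.reverse.map (algebraMap ℤ ℚ) := by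
      apply minpoly.dvd
      rw [Polynomial.aeval_map_algebraMap]
      exact hG1
    have hG2 : Polynomial.eval₂ (algebraMap ℤ ℝ) β' G.reverse = 0 := by
      obtain ⟨Q, hQ⟩ := hdvd
      have h3 : Polynomial.aeval β' (G.reverse.map (algebraMap ℤ ℚ)) = 0 := by
        rw [hQ, map_mul, hβ', minpoly.aeval, zero_mul]
      rwa [Polynomial.aeval_map_algebraMap] at h3
    let _ := invertibleInvOf (a := β')
    have := (Polynomial.eval₂_reverse_eq_zero_iff (algebraMap ℤ ℝ) (⅟β') G).1
    simpa using this (by simpa using hG2)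
  have hunit : P.coeff 0 = 1 ∨ P.coeff 0 = -1 := by
    have hint : IsIntegral ℤ (β⁻¹ * β'⁻¹) := hβ.isIntegral_inv.mul hinv'
    rw [← mul_inv, hmul] at hint
    have hint' : IsIntegral ℤ ((P.coeff 0 : ℚ)⁻¹) := by
      rw [← isIntegral_algebraMap_iff (B := ℝ) (algebraMap ℚ ℝ).injective]
      simpa using hint
    obtain ⟨n, hn⟩ := IsIntegrallyClosed.isIntegral_iff.1 hint'
    have hc0 : P.coeff 0 ≠ 0 := by
      intro h0
      rw [h0, Int.cast_zero] at hmul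
      rcases mul_eq_zero.1 hmul with h | h
      · exact hβ0 h
      · exact hβ'0 h
    have h1 : P.coeff 0 * n = 1 := by
      have : (P.coeff 0 : ℚ) * n = 1 := by
        rw [show (n : ℚ) = algebraMap ℤ ℚ n from rfl, hn]
        exact mul_inv_cancel₀ (by exact_mod_cast hc0)
      exact_mod_cast this
    exact Int.isUnit_iff.1 (IsUnit.of_mul_eq_one _ h1)
  exact ⟨_, _, hβ.one_lt, hunit, hadd, hmul, hirr⟩

namespace IsQuadraticUnitPair

variable {β β' : ℝ} {m ε : ℤ}

theorem sq_eq (h : IsQuadraticUnitPair β β' m ε) : β ^ 2 = m * β - ε := by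
  rw [← h.add_eq, ← h.mul_eq]; ring

theorem sign_sq (h : IsQuadraticUnitPair β β' m ε) : (ε : ℝ) * ε = 1 := by
  rcases h.sign with h | h <;> rw [h] <;> simp

theorem conj_eq (h : IsQuadraticUnitPair β β' m ε) : β' = ε / β := by
  have := h.one_lt
  rw [eq_div_iff (by linarith), mul_comm, h.mul_eq]

theorem conj_sq_eq (h : IsQuadraticUnitPair β β' m ε) : β' ^ 2 = m * β' - ε := by
  rw [← h.add_eq, ← h.mul_eq]; ring

theorem abs_conj (h : IsQuadraticUnitPair β β' m ε) : |β'| = 1 / β := by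
  have := h.one_lt
  rw [h.conj_eq, abs_div, abs_of_pos (by linarith : 0 < β)]
  rcases h.sign with h | h <;> rw [h] <;> simp

theorem injective (h : IsQuadraticUnitPair β β' m ε) : Function.Injective (latticeValue β) := by
  rw [injective_iff_map_eq_zero]
  rintro ⟨p, q⟩ hv
  rw [latticeValue_apply] at hv
  simp only at hv
  by_cases hq : q = 0
  · subst hq
    simp at hv
    simp [hv]
  · exfalso
    apply h.irrational
    refine ⟨-p / q, ?_⟩
    have : (q : ℝ) ≠ 0 := by exact_mod_cast hq
    push_cast
    rw [div_eq_iff this]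
    linarith

theorem exists_mul (h : IsQuadraticUnitPair β β' m ε) (v : ℤ × ℤ) :
    ∃ v', latticeValue β v' = β * latticeValue β v ∧
      latticeValue β' v' = β' * latticeValue β' v := by
  refine ⟨(-ε * v.2, v.1 + m * v.2), ?_, ?_⟩ <;> simp only [latticeValue_apply] <;> push_cast
  · linear_combination (-v.2 : ℝ) * h.sq_eq
  · linear_combination (-v.2 : ℝ) * h.conj_sq_eq

/-- This is where the norm `ε = ±1` matters: `β⁻¹ = ε (m - β)` lies in `ℤ[β]`. -/
theorem exists_div (h : IsQuadraticUnitPair β β' m ε) (v : ℤ × ℤ) :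
    ∃ v', β * latticeValue β v' = latticeValue β v ∧
      β' * latticeValue β' v' = latticeValue β' v := by
  refine ⟨(v.2 + ε * m * v.1, -ε * v.1), ?_, ?_⟩ <;> simp only [latticeValue_apply] <;> push_cast
  · linear_combination (-ε * v.1 : ℝ) * h.sq_eq + v.1 * h.sign_sq
  · linear_combination (-ε * v.1 : ℝ) * h.conj_sq_eq + v.1 * h.sign_sq

/-- Euclidean step: removal of a digit `a` and division by `σ * β`. -/
theorem exists_digit (h : IsQuadraticUnitPair β β' m ε) {σ : ℤ} (hσ : σ = 1 ∨ σ = -1)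
    (v : ℤ × ℤ) (a : ℤ) :
    ∃ v', latticeValue β v = a + σ * β * latticeValue β v' ∧
      latticeValue β' v = a + σ * β' * latticeValue β' v' := by
  obtain ⟨v', h1, h2⟩ := h.exists_div (v - (a, 0))
  rw [map_sub] at h1 h2
  have e : ∀ θ : ℝ, latticeValue θ (a, 0) = a := by intro θ; simp [latticeValue_apply]
  rw [e] at h1 h2
  rcases hσ with rfl | rfl
  · refine ⟨v', ?_, ?_⟩ <;> push_cast <;> linarith
  · refine ⟨-v', ?_, ?_⟩ <;> rw [map_neg] <;> push_cast <;> linarith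

theorem exists_pow (h : IsQuadraticUnitPair β β' m ε) (n : ℕ) :
    ∃ v, latticeValue β v = β ^ n ∧ latticeValue β' v = β' ^ n := by
  induction n with
  | zero => exact ⟨(1, 0), by simp [latticeValue_apply], by simp [latticeValue_apply]⟩
  | succ n ih =>
    obtain ⟨v, h1, h2⟩ := ih
    obtain ⟨v', h3, h4⟩ := h.exists_mul v
    exact ⟨v', by rw [h3, h1]; ring, by rw [h4, h2]; ring⟩

theorem exists_pow_mul (h : IsQuadraticUnitPair β β' m ε) (n : ℕ) (v : ℤ × ℤ) :
    ∃ v', latticeValue β v' = β ^ n * latticeValue β v := by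
  induction n with
  | zero => exact ⟨v, by simp⟩
  | succ n ih =>
    obtain ⟨v', h1⟩ := ih
    obtain ⟨v'', h3, -⟩ := h.exists_mul v'
    exact ⟨v'', by rw [h3, h1]; ring⟩

theorem exists_inv_pow_mul (h : IsQuadraticUnitPair β β' m ε) (n : ℕ) (v : ℤ × ℤ) :
    ∃ v', β ^ n * latticeValue β v' = latticeValue β v ∧
      β' ^ n * latticeValue β' v' = latticeValue β' v := by
  induction n with
  | zero => exact ⟨v, by simp, by simp⟩
  | succ n ih =>
    obtain ⟨v', h1, h2⟩ := ih
    obtain ⟨v'', h3, h4⟩ := h.exists_div v'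
    exact ⟨v'', by rw [← h1, ← h3]; ring, by rw [← h2, ← h4]; ring⟩

/-- Even powers of `β'` are positive and tend to zero. -/
theorem exists_small (h : IsQuadraticUnitPair β β' m ε) {e : ℝ} (he : 0 < e) :
    ∃ v, 0 < latticeValue β' v ∧ latticeValue β' v < e := by
  have h1 := h.one_lt
  have hb : |β'| < 1 := by rw [h.abs_conj, div_lt_one (by linarith)]; exact h1
  have hb0 : β' ≠ 0 := by
    rw [← abs_pos, h.abs_conj]; positivity
  obtain ⟨n, hn⟩ := exists_pow_lt_of_lt_one he (y := β' ^ 2) (by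
    rw [← sq_abs]; exact pow_lt_one₀ (abs_nonneg _) hb two_ne_zero)
  obtain ⟨v, -, hv⟩ := h.exists_pow (2 * n)
  refine ⟨v, ?_, ?_⟩
  · rw [hv, pow_mul]; positivity
  · rw [hv, pow_mul]; exact hn

/-- The two values of `(p, q)` differ by `q (β - β')`, which bounds `q` and then `p`. This
finiteness makes the descent arguments below terminate. -/
theorem finite_bounded (h : IsQuadraticUnitPair β β' m ε) (B C : ℝ) :
    {v : ℤ × ℤ | |latticeValue β v| ≤ B ∧ |latticeValue β' v| ≤ C}.Finite := by
  have h1 := h.one_lt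
  have hb : |β'| < 1 := by rw [h.abs_conj, div_lt_one (by linarith)]; exact h1
  have hd : 0 < β - β' := by have := le_abs_self β'; linarith
  obtain ⟨N, hN⟩ := exists_nat_ge ((B + C) / (β - β'))
  obtain ⟨N', hN'⟩ := exists_nat_ge (C + N)
  refine ((Set.finite_Icc (-(N' : ℤ)) N').prod (Set.finite_Icc (-(N : ℤ)) N)).subset ?_
  rintro ⟨p, q⟩ ⟨hB, hC⟩
  simp only [latticeValue_apply] at hB hC
  have hq : |(q : ℝ)| ≤ N := by
    refine le_trans ?_ hN
    rw [le_div_iff₀ hd]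
    calc |(q : ℝ)| * (β - β') = |(q : ℝ) * (β - β')| := by rw [abs_mul, abs_of_pos hd]
      _ = |((p : ℝ) + q * β) - (p + q * β')| := by congr 1; ring
      _ ≤ _ := (abs_sub _ _).trans (add_le_add hB hC)
  have hp : |(p : ℝ)| ≤ N' := by
    refine le_trans ?_ hN'
    calc |(p : ℝ)| = |((p : ℝ) + q * β') - q * β'| := by congr 1; ring
      _ ≤ |(p : ℝ) + q * β'| + |q * β'| := abs_sub _ _
      _ ≤ C + N := by
        rw [abs_mul]
        have := abs_nonneg (q : ℝ)
        have := abs_nonneg β'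
        nlinarith
  rw [abs_le] at hp hq
  simp only [Set.mem_prod, Set.mem_Icc]
  exact ⟨⟨by exact_mod_cast hp.1, by exact_mod_cast hp.2⟩,
    by exact_mod_cast hq.1, by exact_mod_cast hq.2⟩

end IsQuadraticUnitPair

/-! ### The spectrum as the set generated from zero by `x ↦ a + α x`. -/

section DigitSpectrum

variable {A : Finset ℤ} {α : ℝ}

theorem zero_mem_digitSpectrum (h0 : (0 : ℤ) ∈ A) : (0 : ℝ) ∈ digitSpectrum A α :=
  ⟨0, fun _ => 0, fun _ _ => h0, by simp⟩

theorem add_mul_mem_digitSpectrum {a : ℤ} (ha : a ∈ A) {x : ℝ} (hx : x ∈ digitSpectrum A α) :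
    a + α * x ∈ digitSpectrum A α := by
  obtain ⟨n, b, hb, rfl⟩ := hx
  refine ⟨n + 1, fun i => if i = 0 then a else b (i - 1), ?_, ?_⟩
  · intro i hi
    by_cases h : i = 0
    · simpa [h] using ha
    · simpa [h] using hb (i - 1) (by omega)
  · rw [Finset.sum_range_succ' _ (n + 1), Finset.mul_sum]
    simp only [Nat.add_eq_zero_iff, one_ne_zero, and_false, if_false, Nat.add_sub_cancel, if_true,
      pow_zero, mul_one]
    rw [add_comm]
    congr 1
    refine Finset.sum_congr rfl fun i _ => ?_
    rw [pow_succ]; ring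

theorem intCast_mem_digitSpectrum (h0 : (0 : ℤ) ∈ A) {a : ℤ} (ha : a ∈ A) :
    (a : ℝ) ∈ digitSpectrum A α := by
  simpa using add_mul_mem_digitSpectrum (α := α) ha (zero_mem_digitSpectrum h0)

/-- Horner's scheme: the constant digit is split off and the remaining digits are shifted. -/
theorem digitSpectrum_induction {P : ℝ → Prop} (zero : P 0)
    (step : ∀ a ∈ A, ∀ x, P x → P (a + α * x)) {x : ℝ} (hx : x ∈ digitSpectrum A α) : P x := by
  obtain ⟨n, b, hb, rfl⟩ := hx
  induction n generalizing b with
  | zero =>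
    have := step (b 0) (hb 0 le_rfl) 0 zero
    simpa using this
  | succ n ih =>
    have h1 := step (b 0) (hb 0 (by omega)) _ (ih (fun i => b (i + 1)) fun i hi => hb _ (by omega))
    convert h1 using 1
    rw [Finset.sum_range_succ' _ (n + 1), Finset.mul_sum, add_comm]
    congr 1
    · simp
    · refine Finset.sum_congr rfl fun i _ => ?_
      rw [pow_succ]; ring

theorem exists_eq_add_mul_of_mem_digitSpectrum (h0 : (0 : ℤ) ∈ A) {x : ℝ}
    (hx : x ∈ digitSpectrum A α) : ∃ a ∈ A, ∃ y ∈ digitSpectrum A α, x = a + α * y := by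
  have : x ∈ digitSpectrum A α ∧ ∃ a ∈ A, ∃ y ∈ digitSpectrum A α, x = a + α * y :=
    digitSpectrum_induction
      (P := fun x => x ∈ digitSpectrum A α ∧ ∃ a ∈ A, ∃ y ∈ digitSpectrum A α, x = a + α * y)
      ⟨zero_mem_digitSpectrum h0, 0, h0, 0, zero_mem_digitSpectrum h0, by simp⟩
      (fun a ha x ih => ⟨add_mul_mem_digitSpectrum ha ih.1, a, ha, x, ih.1, rfl⟩) hx
  exact this.2

theorem digitSpectrum_mono {B : Finset ℤ} (h : A ⊆ B) : digitSpectrum A α ⊆ digitSpectrum B α := by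
  rintro x ⟨n, a, ha, rfl⟩
  exact ⟨n, a, fun i hi => h (ha i hi), rfl⟩

theorem neg_mem_digitSpectrum {s t : ℤ} {x : ℝ}
    (hx : x ∈ digitSpectrum (Finset.Icc (-s) t) α) :
    -x ∈ digitSpectrum (Finset.Icc (-t) s) α := by
  obtain ⟨n, a, ha, rfl⟩ := hx
  refine ⟨n, fun i => -a i, fun i hi => ?_, ?_⟩
  · have := Finset.mem_Icc.1 (ha i hi)
    rw [Finset.mem_Icc]
    dsimp only
    omega
  · rw [← Finset.sum_neg_distrib]
    refine Finset.sum_congr rfl fun i _ => ?_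
    push_cast; ring

theorem neg_mem_digitSpectrum_iff {s t : ℤ} {x : ℝ} :
    -x ∈ digitSpectrum (Finset.Icc (-t) s) α ↔ x ∈ digitSpectrum (Finset.Icc (-s) t) α :=
  ⟨fun h => by simpa using neg_mem_digitSpectrum h, neg_mem_digitSpectrum⟩

end DigitSpectrum

/-! ### The window of the conjugates and division steps that stay in it. -/

/-- The centre of the attractor of the maps `y ↦ a + γ y`, for digits `-s ≤ a ≤ t`. -/
noncomputable def windowCenter (γ : ℝ) (s t : ℤ) : ℝ := (t - s) / (2 * (1 - γ))

/-- Half of the length of the attractor of the maps `y ↦ a ± y / β`, for digits `-s ≤ a ≤ t`. -/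
noncomputable def windowRadius (β : ℝ) (s t : ℤ) : ℝ := (s + t) * β / (2 * (β - 1))

theorem windowCenter_eq {γ : ℝ} (hγ : γ ≠ 1) (s t : ℤ) :
    windowCenter γ s t = (t - s) / 2 + γ * windowCenter γ s t := by
  unfold windowCenter
  have : 1 - γ ≠ 0 := sub_ne_zero.2 hγ.symm
  field_simp
  ring

theorem windowRadius_eq {β : ℝ} (hβ : 1 < β) (s t : ℤ) :
    windowRadius β s t = (s + t) / 2 + windowRadius β s t / β := by
  unfold windowRadius
  have : β - 1 ≠ 0 := by linarith
  have : β ≠ 0 := by linarith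
  field_simp
  ring

/-- The hypothesis that there are more than `β` digits enters here: the images of the window under
`y ↦ a + γ y`, of radius `R / β > 1 / 2` around centres one apart, overlap. -/
theorem lt_windowRadius {β : ℝ} (hβ : 1 < β) {s t : ℤ} (hst : β < s + t + 1) :
    β / 2 < windowRadius β s t := by
  unfold windowRadius
  rw [div_lt_div_iff₀ (by norm_num) (by linarith)]
  nlinarith

theorem abs_windowCenter_le {β γ : ℝ} (hβ : 1 < β) (hγ : |γ| = 1 / β) {s t : ℤ} (hs : 0 ≤ s)
    (ht : 0 ≤ t) : |windowCenter γ s t| ≤ windowRadius β s t := by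
  have h1 : 1 / β < 1 := by rw [div_lt_one (by linarith)]; exact hβ
  have hγ1 : γ ≤ 1 / β := hγ ▸ le_abs_self γ
  have hs' : (0 : ℝ) ≤ s := by exact_mod_cast hs
  have ht' : (0 : ℝ) ≤ t := by exact_mod_cast ht
  have hR : windowRadius β s t = (s + t) / (2 * (1 - 1 / β)) := by
    unfold windowRadius
    have : β - 1 ≠ 0 := by linarith
    have : β ≠ 0 := by linarith
    field_simp
  rw [hR, windowCenter, abs_div, abs_of_pos (by linarith : 0 < 2 * (1 - γ))]
  apply div_le_div₀ (by linarith) _ (by linarith) (by linarith)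
  rw [abs_le]; constructor <;> linarith

/-- Rounding to a digit. -/
theorem exists_digit_abs_sub_lt {s t : ℤ} (hs : 0 ≤ s) (ht : 0 ≤ t) {x ρ : ℝ} (hρ : 1 / 2 < ρ)
    (hx : |x - (t - s) / 2| < (s + t) / 2 + ρ) : ∃ a ∈ Finset.Icc (-s) t, |x - a| < ρ := by
  rw [abs_lt] at hx
  by_cases h1 : (t : ℝ) < x
  · refine ⟨t, by rw [Finset.mem_Icc]; omega, ?_⟩
    rw [abs_lt]; constructor <;> linarith
  by_cases h2 : x < -s
  · refine ⟨-s, by rw [Finset.mem_Icc]; omega, ?_⟩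
    push_cast
    rw [abs_lt]; constructor <;> linarith
  push Not at h1 h2
  have h3 := abs_sub_round x
  -- Within the digit range the nearest integer is off by at most `1 / 2 < ρ`; outside it the end
  -- digit was used.
  refine ⟨round x, ?_, h3.trans_lt hρ⟩
  rw [abs_le] at h3
  rw [Finset.mem_Icc]
  constructor
  · have : (-s : ℝ) - 1 < round x := by linarith
    have : -s - 1 < round x := by exact_mod_cast this
    omega
  · have : (round x : ℝ) < t + 1 := by linarith
    have : round x < t + 1 := by exact_mod_cast this
    omega

namespace IsQuadraticUnitPair

variable {β β' : ℝ} {m ε : ℤ}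

theorem abs_sign_mul_conj (h : IsQuadraticUnitPair β β' m ε) {σ : ℤ} (hσ : σ = 1 ∨ σ = -1) :
    |σ * β'| = 1 / β := by
  rw [abs_mul, h.abs_conj]
  rcases hσ with rfl | rfl <;> simp

theorem sign_mul_conj_ne_one (h : IsQuadraticUnitPair β β' m ε) {σ : ℤ} (hσ : σ = 1 ∨ σ = -1) :
    σ * β' ≠ 1 := by
  intro h1
  have h2 := h.abs_sign_mul_conj hσ
  have h3 := h.one_lt
  rw [h1, abs_one, eq_div_iff (by linarith)] at h2
  linarith

variable {σ : ℤ} {s t : ℤ}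

/-- The window contains zero and is mapped into itself by every `y ↦ a + σ β' y`. -/
theorem exists_of_mem_digitSpectrum (h : IsQuadraticUnitPair β β' m ε) (hσ : σ = 1 ∨ σ = -1)
    (hs : 0 ≤ s) (ht : 0 ≤ t) {x : ℝ} (hx : x ∈ digitSpectrum (Finset.Icc (-s) t) (σ * β)) :
    ∃ v, latticeValue β v = x ∧
      |latticeValue β' v - windowCenter (σ * β') s t| ≤ windowRadius β s t := by
  refine digitSpectrum_induction (P := fun x => ∃ v, latticeValue β v = x ∧
      |latticeValue β' v - windowCenter (σ * β') s t| ≤ windowRadius β s t) ?_ ?_ hx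
  · refine ⟨0, by simp, ?_⟩
    rw [map_zero, zero_sub, abs_neg]
    exact abs_windowCenter_le h.one_lt (h.abs_sign_mul_conj hσ) hs ht
  · rintro a ha _ ⟨v, rfl, hv⟩
    obtain ⟨v', h1, h2⟩ := h.exists_mul v
    have e : ∀ θ : ℝ, latticeValue θ (a, 0) = a := by intro θ; simp [latticeValue_apply]
    refine ⟨(a, 0) + σ • v', ?_, ?_⟩
    · rw [map_add, map_zsmul, h1, e, zsmul_eq_mul]; ring
    · rw [map_add, map_zsmul, h2, e, zsmul_eq_mul]
      rw [windowCenter_eq (h.sign_mul_conj_ne_one hσ), windowRadius_eq h.one_lt]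
      set k := windowCenter (σ * β') s t
      have e1 : (a : ℝ) + σ * (β' * latticeValue β' v) - ((t - s) / 2 + σ * β' * k) =
          (a - (t - s) / 2) + σ * β' * (latticeValue β' v - k) := by ring
      rw [e1]
      refine (abs_add_le _ _).trans (add_le_add ?_ ?_)
      · rw [Finset.mem_Icc] at ha
        have h3 : (-s : ℝ) ≤ a := by exact_mod_cast ha.1
        have h4 : (a : ℝ) ≤ t := by exact_mod_cast ha.2
        rw [abs_le]; constructor <;> linarith
      · rw [abs_mul, h.abs_sign_mul_conj hσ, div_mul_eq_mul_div, one_mul]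
        have := h.one_lt
        gcongr

theorem abs_conj_sub_center_le (h : IsQuadraticUnitPair β β' m ε) (hσ : σ = 1 ∨ σ = -1)
    (hs : 0 ≤ s) (ht : 0 ≤ t) {v : ℤ × ℤ}
    (hv : latticeValue β v ∈ digitSpectrum (Finset.Icc (-s) t) (σ * β)) :
    |latticeValue β' v - windowCenter (σ * β') s t| ≤ windowRadius β s t := by
  obtain ⟨v', h1, h2⟩ := h.exists_of_mem_digitSpectrum hσ hs ht hv
  rwa [h.injective h1] at h2

/-- Two points never sit at opposite ends of the closed window: each digit contributes at most `s +
t` to the difference, the rest is contracted by `1 / β`, and the strict inequality at zero persists.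
The strictness is what excludes coefficients of opposite signs when `g u - g w = 2 * R`. -/
theorem abs_conj_sub_conj_lt (h : IsQuadraticUnitPair β β' m ε) (hσ : σ = 1 ∨ σ = -1)
    (hs : 0 ≤ s) (ht : 0 ≤ t) (hst : 0 < s + t) {v w : ℤ × ℤ}
    (hv : latticeValue β v ∈ digitSpectrum (Finset.Icc (-s) t) (σ * β))
    (hw : latticeValue β w ∈ digitSpectrum (Finset.Icc (-s) t) (σ * β)) :
    |latticeValue β' v - latticeValue β' w| < 2 * windowRadius β s t := by
  have h0 : (0 : ℤ) ∈ Finset.Icc (-s) t := by rw [Finset.mem_Icc]; omega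
  have hb := h.one_lt
  have hst' : (0 : ℝ) < s + t := by exact_mod_cast hst
  refine digitSpectrum_induction (P := fun x => ∀ v w, latticeValue β v = x →
    latticeValue β w ∈ digitSpectrum (Finset.Icc (-s) t) (σ * β) →
    |latticeValue β' v - latticeValue β' w| < 2 * windowRadius β s t) ?_ ?_ hv v w rfl hw
  · intro v w hx hw
    have hv0 : v = 0 := h.injective (by rw [hx, map_zero])
    subst hv0
    refine digitSpectrum_induction (P := fun y => ∀ w, latticeValue β w = y →
      |latticeValue β' 0 - latticeValue β' w| < 2 * windowRadius β s t) ?_ ?_ hw w rfl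
    · intro w hy
      have hw0 : w = 0 := h.injective (by rw [hy, map_zero])
      subst hw0
      have : 0 < windowRadius β s t := by
        unfold windowRadius
        have : 0 < β - 1 := by linarith
        positivity
      simpa using this
    · intro b hb' y ih w hy
      obtain ⟨w', h1, h2⟩ := h.exists_digit hσ w b
      have hσb : (σ : ℝ) * β ≠ 0 := by
        rcases hσ with rfl | rfl <;> simp <;> linarith
      have e1 : latticeValue β w' = y := by
        apply mul_left_cancel₀ hσb; rw [hy] at h1; linarith
      have h3 := ih w' e1
      rw [h2, map_zero, windowRadius_eq hb]
      rw [map_zero] at h3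
      rw [Finset.mem_Icc] at hb'
      have h4 : (-s : ℝ) ≤ b := by exact_mod_cast hb'.1
      have h5 : (b : ℝ) ≤ t := by exact_mod_cast hb'.2
      have hs' : (0 : ℝ) ≤ s := by exact_mod_cast hs
      have ht' : (0 : ℝ) ≤ t := by exact_mod_cast ht
      have e2 : 0 - ((b : ℝ) + σ * β' * latticeValue β' w') =
        -b + σ * β' * (0 - latticeValue β' w') := by ring
      have e3 : |σ * β' * (0 - latticeValue β' w')| < 2 * windowRadius β s t / β := by
        rw [abs_mul, h.abs_sign_mul_conj hσ, div_mul_eq_mul_div, one_mul]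
        gcongr
      have e4 : |-(b : ℝ)| ≤ s + t := by rw [abs_le]; constructor <;> linarith
      rw [e2]
      refine (abs_add_le _ _).trans_lt ?_
      have e5 : 2 * windowRadius β s t / β = 2 * (windowRadius β s t / β) := by ring
      linarith
  · intro a ha x ih v w hx hw
    obtain ⟨v', h1, h2⟩ := h.exists_digit hσ v a
    obtain ⟨b, hb', y, hy, hwy⟩ := exists_eq_add_mul_of_mem_digitSpectrum h0 hw
    obtain ⟨w', h3, h4⟩ := h.exists_digit hσ w b
    have hσb : (σ : ℝ) * β ≠ 0 := by
      rcases hσ with rfl | rfl <;> simp <;> linarith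
    have e1 : latticeValue β v' = x := by
      apply mul_left_cancel₀ hσb; rw [hx] at h1; linarith
    have e2 : latticeValue β w' = y := by
      apply mul_left_cancel₀ hσb; rw [hwy] at h3; linarith
    have h5 := ih v' w' e1 (e2 ▸ hy)
    rw [h2, h4, windowRadius_eq hb]
    rw [Finset.mem_Icc] at ha hb'
    have h6 : (-s : ℝ) ≤ a := by exact_mod_cast ha.1
    have h7 : (a : ℝ) ≤ t := by exact_mod_cast ha.2
    have h8 : (-s : ℝ) ≤ b := by exact_mod_cast hb'.1
    have h9 : (b : ℝ) ≤ t := by exact_mod_cast hb'.2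
    have e2 : (a : ℝ) + σ * β' * latticeValue β' v' - (b + σ * β' * latticeValue β' w') =
      (a - b) + σ * β' * (latticeValue β' v' - latticeValue β' w') := by ring
    have e3 : |σ * β' * (latticeValue β' v' - latticeValue β' w')| <
        2 * windowRadius β s t / β := by
      rw [abs_mul, h.abs_sign_mul_conj hσ, div_mul_eq_mul_div, one_mul]
      gcongr
    have e4 : |(a : ℝ) - b| ≤ s + t := by rw [abs_le]; constructor <;> linarith
    rw [e2]
    refine (abs_add_le _ _).trans_lt ?_
    have e5 : 2 * windowRadius β s t / β = 2 * (windowRadius β s t / β) := by ring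
    linarith

/-- Choice of a last digit that keeps the conjugate in a prescribed window. -/
theorem exists_digit_window (h : IsQuadraticUnitPair β β' m ε) (hσ : σ = 1 ∨ σ = -1)
    (hs : 0 ≤ s) (ht : 0 ≤ t) {k R : ℝ} (hR : β / 2 < R) {v : ℤ × ℤ}
    (hv : |latticeValue β' v - ((t - s) / 2 + σ * β' * k)| < (s + t) / 2 + R / β) :
    ∃ a ∈ Finset.Icc (-s) t, ∃ v', latticeValue β v = a + σ * β * latticeValue β v' ∧
      |latticeValue β' v' - k| < R := by
  have hb := h.one_lt
  obtain ⟨a, ha, hlt⟩ := exists_digit_abs_sub_lt hs ht (x := latticeValue β' v - σ * β' * k)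
    (ρ := R / β) (by rw [lt_div_iff₀ (by linarith)]; linarith)
    (by convert hv using 2; ring)
  obtain ⟨v', h1, h2⟩ := h.exists_digit hσ v a
  refine ⟨a, ha, v', h1, ?_⟩
  have e : latticeValue β' v - σ * β' * k - a = σ * β' * (latticeValue β' v' - k) := by
    rw [h2]; ring
  rw [e, abs_mul, h.abs_sign_mul_conj hσ, div_mul_eq_mul_div, one_mul,
    div_lt_div_iff_of_pos_right (by linarith)] at hlt
  exact hlt

/-- If the spectrum contains, in the one-sided case `one` far out, all lattice points with
conjugate in some window that is longer than `β`, then the same holds for every window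
strictly inside the maximal one. -/
theorem mem_digitSpectrum_of_window (h : IsQuadraticUnitPair β β' m ε) (hσ : σ = 1 ∨ σ = -1)
    (hs : 0 ≤ s) (ht : 0 ≤ t) (hst : β < s + t + 1) {one : Prop} (hone : one → σ = 1)
    {k₀ R₀ M₀ : ℝ} (hR₀ : β / 2 < R₀)
    (hwin : ∀ v, (one → M₀ ≤ latticeValue β v) → |latticeValue β' v - k₀| < R₀ →
      latticeValue β v ∈ digitSpectrum (Finset.Icc (-s) t) (σ * β))
    {δ : ℝ} (hδ : 0 < δ) :
    ∃ M : ℝ, ∀ v, (one → M ≤ latticeValue β v) →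
      |latticeValue β' v - windowCenter (σ * β') s t| ≤ windowRadius β s t - δ →
      latticeValue β v ∈ digitSpectrum (Finset.Icc (-s) t) (σ * β) := by
  have hb := h.one_lt
  set γ : ℝ := σ * β' with hγ
  have hγa : |γ| = 1 / β := h.abs_sign_mul_conj hσ
  set k := windowCenter γ s t with hk
  set R := windowRadius β s t with hR
  have hkk : k = (t - s) / 2 + γ * k := windowCenter_eq (h.sign_mul_conj_ne_one hσ) s t
  have hRR : R = (s + t) / 2 + R / β := windowRadius_eq hb s t
  have hRβ : β / 2 < R := lt_windowRadius hb hst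
  -- The radius is a convex combination of `R` and `R₀`, both larger than `β / 2`.
  have hRn : ∀ n : ℕ, β / 2 < R + (R₀ - R) / β ^ n := by
    intro n
    have h1 : (1 : ℝ) ≤ β ^ n := one_le_pow₀ hb.le
    have h2 : 0 < β ^ n := by linarith
    have e : R + (R₀ - R) / β ^ n - β / 2 =
        ((R - β / 2) * (β ^ n - 1) + (R₀ - β / 2)) / β ^ n := by
      field_simp; ring
    have : 0 < R + (R₀ - R) / β ^ n - β / 2 := by
      rw [e]
      apply div_pos _ h2
      have : 0 ≤ (R - β / 2) * (β ^ n - 1) := mul_nonneg (by linarith) (by linarith)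
      linarith
    linarith
  -- Prefixing `n` digits replaces the window `(k₀, R₀)` by one whose centre and radius approach
  -- those of the maximal window geometrically.
  have key : ∀ n : ℕ, ∃ M : ℝ, ∀ v, (one → M ≤ latticeValue β v) →
      |latticeValue β' v - (k + γ ^ n * (k₀ - k))| < R + (R₀ - R) / β ^ n →
      latticeValue β v ∈ digitSpectrum (Finset.Icc (-s) t) (σ * β) := by
    intro n
    induction n with
    | zero =>
      refine ⟨M₀, fun v hv1 hv2 => hwin v hv1 ?_⟩
      simpa using hv2
    | succ n ih =>
      obtain ⟨M, hM⟩ := ih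
      -- Removing a digit `a ≤ t` and dividing by `β` leaves a value of at least `M`.
      refine ⟨β * M + t, fun v hv1 hv2 => ?_⟩
      obtain ⟨a, ha, v', h1, h2⟩ := h.exists_digit_window hσ hs ht (hRn n)
        (k := k + γ ^ n * (k₀ - k)) (v := v) (by
          have e1 : (t - s) / 2 + γ * (k + γ ^ n * (k₀ - k)) = k + γ ^ (n + 1) * (k₀ - k) := by
            rw [pow_succ]; linear_combination -hkk
          have e2 : (s + t) / 2 + (R + (R₀ - R) / β ^ n) / β =
              R + (R₀ - R) / β ^ (n + 1) := by
            rw [pow_succ, ← div_div, add_div R]; linarith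
          rw [← hγ, e1, e2]; exact hv2)
      rw [h1]
      apply add_mul_mem_digitSpectrum ha
      apply hM _ _ h2
      intro ho
      have h3 := hv1 ho
      rw [h1, hone ho] at h3
      have h4 : (a : ℝ) ≤ t := by exact_mod_cast (Finset.mem_Icc.1 ha).2
      push_cast at h3
      have h5 : β * M ≤ β * latticeValue β v' := by linarith
      exact le_of_mul_le_mul_left h5 (by linarith)
  have hlim : Tendsto (fun n : ℕ => |γ ^ n * (k₀ - k)| + |(R₀ - R) / β ^ n|) atTop (𝓝 0) := by
    have h1 : Tendsto (fun n : ℕ => γ ^ n * (k₀ - k)) atTop (𝓝 0) := by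
      have := (tendsto_pow_atTop_nhds_zero_of_abs_lt_one (r := γ) (by
        rw [hγa, div_lt_one (by linarith)]; exact hb)).mul_const (k₀ - k)
      simpa using this
    have h2 : Tendsto (fun n : ℕ => (R₀ - R) / β ^ n) atTop (𝓝 0) :=
      tendsto_const_nhds.div_atTop (tendsto_pow_atTop_atTop_of_one_lt hb)
    simpa using h1.abs.add h2.abs
  obtain ⟨n, hn⟩ := (hlim.eventually_lt_const hδ).exists
  obtain ⟨M, hM⟩ := key n
  refine ⟨M, fun v hv1 hv2 => hM v hv1 ?_⟩
  have e : latticeValue β' v - (k + γ ^ n * (k₀ - k)) =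
      (latticeValue β' v - k) - γ ^ n * (k₀ - k) := by ring
  rw [e]
  refine (abs_sub _ _).trans_lt ?_
  have := neg_abs_le ((R₀ - R) / β ^ n)
  linarith

end IsQuadraticUnitPair

/-! ### Finite base cases for the smallest digit sets. -/

/-- The denominators of centre and radius are cleared. The centre has denominator `β - 1` when the
ratio of the maps is `1 / β` and `β + 1` when it is `-1 / β`; values need the closed version,
conjugates the open one. -/
theorem mul_bounds_of_abs_sub_le_sub {β x a b : ℝ} (hβ : 1 < β)
    (h : |x - (a - b) / (2 * (β - 1))| ≤ (a + b) / (2 * (β - 1))) :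
    -b ≤ (β - 1) * x ∧ (β - 1) * x ≤ a := by
  have h1 : 0 < β - 1 := by linarith
  have e : x - (a - b) / (2 * (β - 1)) = (2 * (β - 1) * x - (a - b)) / (2 * (β - 1)) := by
    field_simp
  rw [e, abs_div, abs_of_pos (by linarith : 0 < 2 * (β - 1)),
    div_le_div_iff_of_pos_right (by linarith), abs_le] at h
  constructor <;> linarith

theorem mul_bounds_of_abs_sub_lt_sub {β x a b : ℝ} (hβ : 1 < β)
    (h : |x - (a - b) / (2 * (β - 1))| < (a + b) / (2 * (β - 1))) :
    -b < (β - 1) * x ∧ (β - 1) * x < a := by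
  have h1 : 0 < β - 1 := by linarith
  have e : x - (a - b) / (2 * (β - 1)) = (2 * (β - 1) * x - (a - b)) / (2 * (β - 1)) := by
    field_simp
  rw [e, abs_div, abs_of_pos (by linarith : 0 < 2 * (β - 1)),
    div_lt_div_iff_of_pos_right (by linarith), abs_lt] at h
  constructor <;> linarith

theorem mul_bounds_of_abs_sub_le_add {β x a b : ℝ} (hβ : 1 < β)
    (h : |x - (a - b) / (2 * (β + 1))| ≤ (a + b) / (2 * (β - 1))) :
    -(b * β + a) ≤ (β ^ 2 - 1) * x ∧ (β ^ 2 - 1) * x ≤ a * β + b := by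
  have h1 : 0 < β - 1 := by linarith
  have h2 : 0 < β + 1 := by linarith
  have h3 : 0 < (β - 1) * (β + 1) := by positivity
  have e : x - (a - b) / (2 * (β + 1)) =
      (2 * (β - 1) * (β + 1) * x - (a - b) * (β - 1)) / (2 * ((β - 1) * (β + 1))) := by
    field_simp
  have e' : (a + b) / (2 * (β - 1)) = (a + b) * (β + 1) / (2 * ((β - 1) * (β + 1))) := by
    field_simp
  rw [e, e', abs_div, abs_of_pos (by linarith : 0 < 2 * ((β - 1) * (β + 1))),
    div_le_div_iff_of_pos_right (by linarith), abs_le] at h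
  constructor <;> linarith

theorem mul_bounds_of_abs_sub_lt_add {β x a b : ℝ} (hβ : 1 < β)
    (h : |x - (a - b) / (2 * (β + 1))| < (a + b) / (2 * (β - 1))) :
    -(b * β + a) < (β ^ 2 - 1) * x ∧ (β ^ 2 - 1) * x < a * β + b := by
  have h1 : 0 < β - 1 := by linarith
  have h2 : 0 < β + 1 := by linarith
  have h3 : 0 < (β - 1) * (β + 1) := by positivity
  have e : x - (a - b) / (2 * (β + 1)) =
      (2 * (β - 1) * (β + 1) * x - (a - b) * (β - 1)) / (2 * ((β - 1) * (β + 1))) := by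
    field_simp
  have e' : (a + b) / (2 * (β - 1)) = (a + b) * (β + 1) / (2 * ((β - 1) * (β + 1))) := by
    field_simp
  rw [e, e', abs_div, abs_of_pos (by linarith : 0 < 2 * ((β - 1) * (β + 1))),
    div_lt_div_iff_of_pos_right (by linarith), abs_lt] at h
  constructor <;> linarith

namespace IsQuadraticUnitPair

variable {β β' : ℝ} {m ε σ s t : ℤ}

/-- The positive root in the case of norm one. -/
theorem bounds_of_one (h : IsQuadraticUnitPair β β' m 1) :
    3 ≤ m ∧ (m : ℝ) - 1 < β ∧ β < m ∧ β ^ 2 = m * β - 1 ∧ β * (m - β) = 1 := by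
  have hb := h.one_lt
  have hsq : β ^ 2 = m * β - 1 := by simpa using h.sq_eq
  have hm : (2 : ℝ) < m := by nlinarith [sq_nonneg (β - 1), mul_pos (sub_pos.2 hb) (sub_pos.2 hb)]
  have hm' : 2 < m := by exact_mod_cast hm
  have hm3 : (3 : ℝ) ≤ m := by exact_mod_cast hm'
  have hprod : β * (m - β) = 1 := by linear_combination -hsq
  refine ⟨hm', ?_, ?_, hsq, hprod⟩
  · nlinarith
  · nlinarith

/-- The positive root in the case of norm minus one. -/
theorem bounds_of_neg_one (h : IsQuadraticUnitPair β β' m (-1)) :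
    1 ≤ m ∧ (m : ℝ) < β ∧ β < m + 1 ∧ β ^ 2 = m * β + 1 ∧ β * (β - m) = 1 := by
  have hb := h.one_lt
  have hsq : β ^ 2 = m * β + 1 := by simpa using h.sq_eq
  have hm : (0 : ℝ) < m := by nlinarith
  have hm' : 0 < m := by exact_mod_cast hm
  have hprod : β * (β - m) = 1 := by linear_combination hsq
  refine ⟨hm', ?_, ?_, hsq, hprod⟩
  · nlinarith
  · nlinarith

/-- It suffices to treat the lattice points in the attractor of the division steps. -/
theorem mem_digitSpectrum_of_core (h : IsQuadraticUnitPair β β' m ε) (hσ : σ = 1 ∨ σ = -1)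
    (hs : 0 ≤ s) (ht : 0 ≤ t) (hst : β < s + t + 1)
    (hcore : ∀ v, |latticeValue β v - (s - t) / (2 * (σ * β - 1))| ≤ (s + t) / (2 * (β - 1)) →
      |latticeValue β' v - windowCenter (σ * β') s t| < windowRadius β s t →
      latticeValue β v ∈ digitSpectrum (Finset.Icc (-s) t) (σ * β))
    (v : ℤ × ℤ) (hv : |latticeValue β' v - windowCenter (σ * β') s t| < windowRadius β s t) :
    latticeValue β v ∈ digitSpectrum (Finset.Icc (-s) t) (σ * β) := by
  by_contra hcon
  have hb := h.one_lt
  set k := windowCenter (σ * β') s t with hk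
  set R := windowRadius β s t with hR
  set c : ℝ := (s - t) / (2 * (σ * β - 1)) with hc
  set r : ℝ := (s + t) / (2 * (β - 1)) with hr
  have hσβ : (σ : ℝ) * β - 1 ≠ 0 := by
    rcases hσ with rfl | rfl
    · push_cast; linarith
    · push_cast; intro h0; linarith
  have hσσ : (σ : ℝ) * σ = 1 := by rcases hσ with rfl | rfl <;> simp
  -- `c` and `r` are centre and radius of the interval kept invariant by the division steps `x ↦ (x
  -- - a) / (σ β)`.
  have hcc : σ * β * c = (s - t) / 2 + c := by
    rw [hc]; field_simp; ring
  have hrr : β * r = (s + t) / 2 + r := by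
    have : β - 1 ≠ 0 := by linarith
    rw [hr]; field_simp; ring
  have hkk : k = (t - s) / 2 + σ * β' * k := windowCenter_eq (h.sign_mul_conj_ne_one hσ) s t
  have hRR : R = (s + t) / 2 + R / β := windowRadius_eq hb s t
  set bad : Set (ℤ × ℤ) := {w | |latticeValue β w - c| ≤ |latticeValue β v - c| ∧
    |latticeValue β' w - k| < R ∧
    latticeValue β w ∉ digitSpectrum (Finset.Icc (-s) t) (σ * β)} with hbad
  have hfin : bad.Finite := by
    refine (h.finite_bounded (|latticeValue β v - c| + |c|) (R + |k|)).subset ?_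
    rintro w ⟨h1, h2, -⟩
    constructor
    · have := abs_add_le (latticeValue β w - c) c
      rw [sub_add_cancel] at this
      linarith
    · have := abs_add_le (latticeValue β' w - k) k
      rw [sub_add_cancel] at this
      linarith
  obtain ⟨w, hw, hmin⟩ := Set.exists_min_image bad (fun w => |latticeValue β w - c|) hfin
    ⟨v, le_rfl, hv, hcon⟩
  obtain ⟨hw1, hw2, hw3⟩ := hw
  obtain ⟨a, ha, w', h1, h2⟩ := h.exists_digit_window hσ hs ht (lt_windowRadius hb hst)
    (k := k) (v := w) (by rw [← hkk, ← hRR]; exact hw2)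
  have hw' : latticeValue β w' ∉ digitSpectrum (Finset.Icc (-s) t) (σ * β) := by
    intro hmem
    exact hw3 (h1 ▸ add_mul_mem_digitSpectrum ha hmem)
  have hbig : r < |latticeValue β w - c| := by
    by_contra hle
    exact hw3 (hcore w (not_lt.1 hle) hw2)
  -- Since `(s + t) / 2 = (β - 1) r`, a division step strictly decreases the distance to `c` as long
  -- as that distance exceeds `r`; this contradicts the minimality of `w`.
  have hlt : |latticeValue β w' - c| < |latticeValue β w - c| := by
    have e : σ * β * (latticeValue β w' - c) =
        (latticeValue β w - c) - (a - (t - s) / 2) := by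
      linear_combination -h1 - hcc
    have h3 : β * |latticeValue β w' - c| ≤ |latticeValue β w - c| + (s + t) / 2 := by
      have e2 : β * |latticeValue β w' - c| = |σ * β * (latticeValue β w' - c)| := by
        rw [abs_mul, abs_mul, abs_of_pos (by linarith : 0 < β)]
        rcases hσ with rfl | rfl <;> simp
      rw [e2, e]
      refine (abs_sub _ _).trans (add_le_add le_rfl ?_)
      rw [Finset.mem_Icc] at ha
      have h4 : (-s : ℝ) ≤ a := by exact_mod_cast ha.1
      have h5 : (a : ℝ) ≤ t := by exact_mod_cast ha.2
      rw [abs_le]; constructor <;> linarith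
    nlinarith
  have := hmin w' ⟨hlt.le.trans hw1, h2, hw'⟩
  linarith

/-- Negating a point exchanges `s` and `t`, so only one of `v` and `-v` has to be checked. -/
theorem core_neg {P : ℤ → ℤ → ℤ × ℤ → Prop}
    (hneg : ∀ s t v, P s t v → P t s (-v))
    (hspec : ∀ s t p q, P s t (p, q) → (1 ≤ q ∨ (q = 0 ∧ 0 ≤ p)) →
      latticeValue β (p, q) ∈ digitSpectrum (Finset.Icc (-s) t) (σ * β))
    {v : ℤ × ℤ} (hv : P s t v) :
    latticeValue β v ∈ digitSpectrum (Finset.Icc (-s) t) (σ * β) := by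
  obtain ⟨p, q⟩ := v
  by_cases hpq : 1 ≤ q ∨ (q = 0 ∧ 0 ≤ p)
  · exact hspec s t p q hv hpq
  · have := hspec t s (-p) (-q) (hneg s t _ hv) (by omega)
    have e : latticeValue β (-p, -q) = - latticeValue β (p, q) := by
      rw [← map_neg]; rfl
    rw [e] at this
    exact neg_mem_digitSpectrum_iff.1 this

/-- The base case for the base `β` of norm one. -/
theorem core_mem_of_one_one (h : IsQuadraticUnitPair β β' m ε) (hs : 1 ≤ s) (ht : 1 ≤ t)
    (hst : ε = 1 ∧ s + t = m - 1) (v : ℤ × ℤ)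
    (hv : |latticeValue β v - (s - t) / (2 * ((1 : ℤ) * β - 1))| ≤ (s + t) / (2 * (β - 1)))
    (hv' : |latticeValue β' v - windowCenter ((1 : ℤ) * β') s t| < windowRadius β s t) :
    latticeValue β v ∈ digitSpectrum (Finset.Icc (-s) t) ((1 : ℤ) * β) := by
  have hb := h.one_lt
  have hβ' : β' = m - β := by linarith [h.add_eq]
  have hconj := h.conj_eq
  rw [Int.cast_one, one_mul] at hv
  have hv := mul_bounds_of_abs_sub_le_sub hb hv
  have h0 : ∀ s t : ℤ, 1 ≤ s → 1 ≤ t →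
      (0 : ℝ) ∈ digitSpectrum (Finset.Icc (-s) t) ((1 : ℤ) * β) := fun s t hs ht =>
    zero_mem_digitSpectrum (by rw [Finset.mem_Icc]; omega)
  obtain ⟨rfl, hst⟩ := hst
  obtain ⟨hm, hm1, hm2, hsq, -⟩ := h.bounds_of_one
  have hw : -(s : ℝ) < (β - 1) * (latticeValue β' v / β) ∧
      (β - 1) * (latticeValue β' v / β) < t := by
    apply mul_bounds_of_abs_sub_lt_sub hb
    have h1 : β - 1 ≠ 0 := by linarith
    have h2 : β ≠ 0 := by linarith
    have e1 : latticeValue β' v / β - ((t : ℝ) - s) / (2 * (β - 1)) =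
        (latticeValue β' v - windowCenter ((1 : ℤ) * β') s t) / β := by
      rw [windowCenter, hconj]
      push_cast
      have : 1 - 1 * (1 / β) ≠ 0 := by
        rw [one_mul, one_sub_div h2]; exact div_ne_zero h1 h2
      field_simp
    have e2 : ((t : ℝ) + s) / (2 * (β - 1)) = windowRadius β s t / β := by
      rw [windowRadius]; field_simp; ring
    rw [e1, e2, abs_div, abs_of_pos (by linarith : 0 < β)]
    gcongr
  refine core_neg (P := fun s t v => 1 ≤ s ∧ 1 ≤ t ∧ s + t = m - 1 ∧
    (-(t : ℝ) ≤ (β - 1) * latticeValue β v ∧ (β - 1) * latticeValue β v ≤ s) ∧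
    (-(s : ℝ) < (β - 1) * (latticeValue β' v / β) ∧
      (β - 1) * (latticeValue β' v / β) < t)) ?_ ?_ ⟨hs, ht, hst, hv, hw⟩
  · rintro s t v ⟨h1, h2, h3, ⟨h4, h5⟩, h6, h7⟩
    simp only [map_neg, neg_div, mul_neg]
    exact ⟨h2, h1, by omega, ⟨by linarith, by linarith⟩, by linarith, by linarith⟩
  · rintro s t p q ⟨h1, h2, h3, ⟨-, h5⟩, h6, -⟩ hpq
    have hsm : s ≤ m - 2 := by omega
    have hsm' : (s : ℝ) ≤ m - 2 := by exact_mod_cast hsm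
    have hs0 : (1 : ℝ) ≤ s := by exact_mod_cast h1
    rw [latticeValue_apply] at h5 h6
    simp only at h5 h6
    rcases hpq with hq | ⟨rfl, hp⟩
    -- Subtracting the lower bound for the conjugate from the upper bound for the value bounds `q (β
    -- - β')`. This gives `q (m - 2) < s ≤ m - 2`, so zero is the only point.
    · exfalso
      have hq' : (1 : ℝ) ≤ q := by exact_mod_cast hq
      have h8 : -(s : ℝ) * β < (β - 1) * (p + q * β') := by
        rw [← mul_div_assoc, lt_div_iff₀ (by linarith)] at h6; exact h6
      have h9 : (β - 1) * (q * (β - β')) < s * (1 + β) := by nlinarith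
      have h10 : β * (β - β') = (β - 1) * (β + 1) := by
        rw [hβ']; linear_combination hsq
      have h11 : q * ((β - 1) ^ 2 * (β + 1)) < s * β * (1 + β) := by
        have : (β - 1) * (q * (β * (β - β'))) < s * (1 + β) * β := by nlinarith
        rw [h10] at this
        linarith
      have h12 : (β - 1) ^ 2 = (m - 2) * β := by linear_combination hsq
      rw [h12] at h11
      have h13 : 0 < β * (β + 1) := by positivity
      have h14 : (q : ℝ) * (m - 2) < s := by
        have : (q * (m - 2)) * (β * (β + 1)) < s * (β * (β + 1)) := by linarith
        exact lt_of_mul_lt_mul_right this h13.le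
      nlinarith
    · have hp0 : p = 0 := by
        by_contra hne
        have hp1 : (1 : ℝ) ≤ p := by exact_mod_cast (by omega : 1 ≤ p)
        simp only [Int.cast_zero, zero_mul, add_zero] at h5
        nlinarith
      subst hp0
      have : latticeValue β ((0 : ℤ), (0 : ℤ)) = 0 := map_zero _
      rw [this]
      exact h0 s t h1 h2
/-- The base case for the base `β` of norm minus one. -/
theorem core_mem_of_one_neg_one (h : IsQuadraticUnitPair β β' m ε) (hs : 1 ≤ s) (ht : 1 ≤ t)
    (hst : (ε = -1 ∧ s + t = m) ∨ (ε = -1 ∧ m = 1 ∧ s = 1 ∧ t = 1)) (v : ℤ × ℤ)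
    (hv : |latticeValue β v - (s - t) / (2 * ((1 : ℤ) * β - 1))| ≤ (s + t) / (2 * (β - 1)))
    (hv' : |latticeValue β' v - windowCenter ((1 : ℤ) * β') s t| < windowRadius β s t) :
    latticeValue β v ∈ digitSpectrum (Finset.Icc (-s) t) ((1 : ℤ) * β) := by
  have hb := h.one_lt
  have hβ' : β' = m - β := by linarith [h.add_eq]
  have hconj := h.conj_eq
  rw [Int.cast_one, one_mul] at hv
  have hv := mul_bounds_of_abs_sub_le_sub hb hv
  have h0 : ∀ s t : ℤ, 1 ≤ s → 1 ≤ t →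
      (0 : ℝ) ∈ digitSpectrum (Finset.Icc (-s) t) ((1 : ℤ) * β) := fun s t hs ht =>
    zero_mem_digitSpectrum (by rw [Finset.mem_Icc]; omega)
  have hε : ε = -1 := by rcases hst with h | h <;> exact h.1
  subst hε
  have hst : s + t = m ∨ (m = 1 ∧ s = 1 ∧ t = 1) := by
    rcases hst with h | h
    · exact Or.inl h.2
    · exact Or.inr h.2
  obtain ⟨hm, hm1, hm2, hsq, hprod⟩ := h.bounds_of_neg_one
  have hw : -((s : ℝ) * β + t) < (β ^ 2 - 1) * (latticeValue β' v / β) ∧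
      (β ^ 2 - 1) * (latticeValue β' v / β) < t * β + s := by
    apply mul_bounds_of_abs_sub_lt_add hb
    have h1 : β - 1 ≠ 0 := by linarith
    have h2 : β ≠ 0 := by linarith
    have h3 : β + 1 ≠ 0 := by linarith
    have e1 : latticeValue β' v / β - ((t : ℝ) - s) / (2 * (β + 1)) =
        (latticeValue β' v - windowCenter ((1 : ℤ) * β') s t) / β := by
      rw [windowCenter, hconj]
      push_cast
      have e3 : 1 - 1 * (-1 / β) = (β + 1) / β := by field_simp; ring
      rw [e3]
      field_simp
    have e2 : ((t : ℝ) + s) / (2 * (β - 1)) = windowRadius β s t / β := by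
      rw [windowRadius]; field_simp; ring
    rw [e1, e2, abs_div, abs_of_pos (by linarith : 0 < β)]
    gcongr
  have hm0 : (1 : ℝ) ≤ m := by exact_mod_cast hm
  refine core_neg (P := fun s t v => 1 ≤ s ∧ 1 ≤ t ∧ (s + t = m ∨ (m = 1 ∧ s = 1 ∧ t = 1)) ∧
    (-(t : ℝ) ≤ (β - 1) * latticeValue β v ∧ (β - 1) * latticeValue β v ≤ s) ∧
    (-((s : ℝ) * β + t) < (β ^ 2 - 1) * (latticeValue β' v / β) ∧
      (β ^ 2 - 1) * (latticeValue β' v / β) < t * β + s)) ?_ ?_ ⟨hs, ht, hst, hv, hw⟩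
  · rintro s t v ⟨h1, h2, h3, ⟨h4, h5⟩, h6, h7⟩
    simp only [map_neg, neg_div, mul_neg]
    exact ⟨h2, h1, by omega, ⟨by linarith, by linarith⟩, by linarith, by linarith⟩
  · rintro s t p q ⟨h1, h2, h3, ⟨-, h5⟩, h6, -⟩ hpq
    have hs0 : (1 : ℝ) ≤ s := by exact_mod_cast h1
    have ht0 : (1 : ℝ) ≤ t := by exact_mod_cast h2
    rw [latticeValue_apply] at h5 h6
    simp only at h5 h6
    have e4 : (β ^ 2 - 1) * ((p + q * β') / β) = m * (p + q * β') := by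
      have : β ≠ 0 := by linarith
      rw [hsq]; field_simp; ring
    rw [e4] at h6
    have h7 : m * β * (p + q * β) ≤ s * (β + 1) := by
      have : (β - 1) * (p + q * β) * (β + 1) ≤ s * (β + 1) := by nlinarith
      have e : m * β = (β - 1) * (β + 1) := by linear_combination -hsq
      rw [e]; linarith
    have h8 : m * (q * (β ^ 2 + 1)) < s * (β + 1) + (s * β + t) * β := by
      have e : β * (β - β') = β ^ 2 + 1 := by rw [hβ']; linear_combination hsq
      rw [← e]
      have : β * (-(s * β + t)) < β * (m * (p + q * β')) :=
        mul_lt_mul_of_pos_left h6 (by linarith)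
      linarith
    -- For `s + t = m` again only zero survives. The golden ratio, `m = 1`, is separate because `m`
    -- is not a sum of two positive digit bounds; there `p + β` with `p ∈ {-1, 0}` and the digits
    -- `0, 1` remain.
    rcases h3 with h3 | ⟨rfl, rfl, rfl⟩
    · have h3' : (s : ℝ) + t = m := by exact_mod_cast h3
      rcases hpq with hq | ⟨rfl, hp⟩
      · exfalso
        have hq' : (1 : ℝ) ≤ q := by exact_mod_cast hq
        have ht' : (t : ℝ) = m - s := by linarith
        have hms : (1 : ℝ) ≤ m - s := by linarith
        have h9 : (m - s) * (β ^ 2 + 1) < m * β := by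
          have h10 : m * (β ^ 2 + 1) ≤ m * (q * (β ^ 2 + 1)) :=
            mul_le_mul_of_nonneg_left (le_mul_of_one_le_left (by positivity) hq') (by linarith)
          rw [ht'] at h8
          linarith
        linarith [le_mul_of_one_le_left (by positivity : 0 ≤ β ^ 2 + 1) hms]
      · have hp0 : p = 0 := by
          by_contra hne
          have hp1 : (1 : ℝ) ≤ p := by exact_mod_cast (by omega : 1 ≤ p)
          simp only [Int.cast_zero, zero_mul, add_zero] at h7
          have hsm : (s : ℝ) ≤ m - 1 := by linarith
          have : m * β ≤ m * β * p := le_mul_of_one_le_right (by positivity) hp1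
          linarith [mul_le_mul_of_nonneg_right hsm (by linarith : 0 ≤ β + 1)]
        subst hp0
        have : latticeValue β ((0 : ℤ), (0 : ℤ)) = 0 := map_zero _
        rw [this]
        exact h0 s t h1 h2
    · push_cast at h6 h7 h8 hsq hm1 hm2 hprod hβ'
      have hd : ∀ d : ℤ, -1 ≤ d → d ≤ 1 →
          (d : ℝ) ∈ digitSpectrum (Finset.Icc (-1 : ℤ) 1) ((1 : ℤ) * β) := by
        intro d hd1 hd2
        exact intCast_mem_digitSpectrum (by decide) (by rw [Finset.mem_Icc]; omega)
      rcases hpq with hq | ⟨rfl, hp⟩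
      · have hq1 : q = 1 := by
          by_contra hne
          have hq2 : (2 : ℝ) ≤ q := by exact_mod_cast (by omega : 2 ≤ q)
          linarith [mul_le_mul_of_nonneg_right hq2 (by positivity : 0 ≤ β ^ 2 + 1)]
        subst hq1
        rw [latticeValue_apply]
        push_cast at h6 h7 ⊢
        have hp1 : p ≤ 0 := by
          by_contra hne
          have hp1 : (1 : ℝ) ≤ p := by exact_mod_cast (by omega : 1 ≤ p)
          linarith [mul_le_mul_of_nonneg_left hp1 (by linarith : 0 ≤ β)]
        have hp2 : -1 ≤ p := by
          by_contra hne
          have hp2 : (p : ℝ) ≤ -2 := by exact_mod_cast (by omega : p ≤ -2)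
          rw [hβ'] at h6
          linarith
        have h9 := add_mul_mem_digitSpectrum (α := (1 : ℤ) * β)
          (show p ∈ Finset.Icc (-1 : ℤ) 1 by rw [Finset.mem_Icc]; omega)
          (hd 1 (by norm_num) (by norm_num))
        simpa using h9
      · have hp1 : p ≤ 1 := by
          by_contra hne
          have hp1 : (2 : ℝ) ≤ p := by exact_mod_cast (by omega : 2 ≤ p)
          simp only [Int.cast_zero, zero_mul, add_zero] at h7
          linarith [mul_le_mul_of_nonneg_left hp1 (by linarith : 0 ≤ β)]
        rw [latticeValue_apply]
        have := hd p (by omega) hp1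
        simpa using this

/-- The base case for the base `-β`, with `β` of norm one. -/
theorem core_mem_of_neg_one_one (h : IsQuadraticUnitPair β β' m ε) (hs : 0 ≤ s) (ht : 0 ≤ t)
    (hst : ε = 1 ∧ s + t = m - 1) (v : ℤ × ℤ)
    (hv : |latticeValue β v - (s - t) / (2 * ((-1 : ℤ) * β - 1))| ≤ (s + t) / (2 * (β - 1)))
    (hv' : |latticeValue β' v - windowCenter ((-1 : ℤ) * β') s t| < windowRadius β s t) :
    latticeValue β v ∈ digitSpectrum (Finset.Icc (-s) t) ((-1 : ℤ) * β) := by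
  have hb := h.one_lt
  have hβ' : β' = m - β := by linarith [h.add_eq]
  have hconj := h.conj_eq
  have hbp : 0 < β := by linarith
  have n1 : β - 1 ≠ 0 := by linarith
  have n2 : β ≠ 0 := by linarith
  have n3 : β + 1 ≠ 0 := by linarith
  have hv : -((s : ℝ) * β + t) ≤ (β ^ 2 - 1) * latticeValue β v ∧
      (β ^ 2 - 1) * latticeValue β v ≤ t * β + s := by
    apply mul_bounds_of_abs_sub_le_add hb
    rw [add_comm (t : ℝ)]
    convert hv using 3
    push_cast
    rw [show (-1 : ℝ) * β - 1 = -(β + 1) by ring]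
    field_simp
    ring
  have h0 : ∀ s t : ℤ, 0 ≤ s → 0 ≤ t →
      (0 : ℝ) ∈ digitSpectrum (Finset.Icc (-s) t) ((-1 : ℤ) * β) := fun s t hs ht =>
    zero_mem_digitSpectrum (by rw [Finset.mem_Icc]; omega)
  obtain ⟨rfl, hst⟩ := hst
  obtain ⟨hm, hm1, hm2, hsq, hprod⟩ := h.bounds_of_one
  have hm3 : (3 : ℝ) ≤ m := by exact_mod_cast hm
  have hw : -((s : ℝ) * β + t) < (β ^ 2 - 1) * (latticeValue β' v / β) ∧
      (β ^ 2 - 1) * (latticeValue β' v / β) < t * β + s := by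
    apply mul_bounds_of_abs_sub_lt_add hb
    have e1 : latticeValue β' v / β - ((t : ℝ) - s) / (2 * (β + 1)) =
        (latticeValue β' v - windowCenter ((-1 : ℤ) * β') s t) / β := by
      rw [windowCenter, hconj]
      push_cast
      have e3 : 1 - -1 * (1 / β) = (β + 1) / β := by field_simp; ring
      rw [e3]
      field_simp
    have e2 : ((t : ℝ) + s) / (2 * (β - 1)) = windowRadius β s t / β := by
      rw [windowRadius]; field_simp; ring
    rw [e1, e2, abs_div, abs_of_pos hbp]
    gcongr
  refine core_neg (P := fun s t v => 0 ≤ s ∧ 0 ≤ t ∧ s + t = m - 1 ∧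
    (-((s : ℝ) * β + t) ≤ (β ^ 2 - 1) * latticeValue β v ∧
      (β ^ 2 - 1) * latticeValue β v ≤ t * β + s) ∧
    (-((s : ℝ) * β + t) < (β ^ 2 - 1) * (latticeValue β' v / β) ∧
      (β ^ 2 - 1) * (latticeValue β' v / β) < t * β + s)) ?_ ?_ ⟨hs, ht, hst, hv, hw⟩
  · rintro s t v ⟨h1, h2, h3, ⟨h4, h5⟩, h6, h7⟩
    simp only [map_neg, neg_div, mul_neg]
    exact ⟨h2, h1, by omega, ⟨by linarith, by linarith⟩, by linarith, by linarith⟩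
  · rintro s t p q ⟨h1, h2, h3, ⟨-, h5⟩, h6, -⟩ hpq
    have hs0 : (0 : ℝ) ≤ s := by exact_mod_cast h1
    have ht0 : (0 : ℝ) ≤ t := by exact_mod_cast h2
    have h3' : (s : ℝ) + t = m - 1 := by exact_mod_cast h3
    rw [latticeValue_apply] at h5 h6
    simp only at h5 h6
    rw [← mul_div_assoc, lt_div_iff₀ hbp] at h6
    rcases hpq with hq | ⟨rfl, hp⟩
    · exfalso
      have hq' : (1 : ℝ) ≤ q := by exact_mod_cast hq
      have h8 : q * ((β ^ 2 - 1) * (β - β')) < t * β + s + (s * β + t) * β := by linarith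
      have h10 : β * (β - β') = β ^ 2 - 1 := by rw [hβ']; linear_combination hsq
      have h11 : q * (β ^ 2 - 1) ^ 2 < (t * β + s + (s * β + t) * β) * β := by
        have : q * ((β ^ 2 - 1) * (β - β')) * β < (t * β + s + (s * β + t) * β) * β := by
          gcongr
        calc q * (β ^ 2 - 1) ^ 2 = q * ((β ^ 2 - 1) * (β - β')) * β := by
              rw [sq (β ^ 2 - 1)]; nth_rewrite 2 [← h10]; ring
          _ < _ := this
      have h12 : (β ^ 2 - 1) ^ 2 = (m ^ 2 - 4) * β ^ 2 := by
        linear_combination (β ^ 2 + 1 + m * β) * hsq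
      have h13 : (t * β + s + (s * β + t) * β) * β = (2 * t + s * m) * β ^ 2 := by
        linear_combination s * β * hsq
      rw [h12, h13, ← mul_assoc] at h11
      have h14 : (q : ℝ) * (m ^ 2 - 4) < 2 * t + s * m :=
        lt_of_mul_lt_mul_right h11 (by positivity)
      have h15 : q * (m ^ 2 - 4) < 2 * t + s * m := by exact_mod_cast h14
      have h16 : t = m - 1 - s := by omega
      have hms : 1 ≤ m - s := by omega
      -- With `1 ≤ m - s` this leaves only `m = 3`, `s = 2`, `t = 0`, `q = 1`, where the bounds on
      -- the value and on the conjugate exclude `p ≥ -2` and `p ≤ -3` respectively.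
      have h17 : (m - s) * (m - 2) < 2 := by
        subst h16
        have : 0 ≤ (q - 1) * (m ^ 2 - 4) := mul_nonneg (by omega) (by nlinarith)
        linarith
      have hm3 : m = 3 := by
        by_contra hne
        have : 2 ≤ m - 2 := by omega
        linarith [mul_le_mul hms this (by norm_num) (by omega)]
      subst hm3
      have hs2 : s = 2 := by omega
      subst hs2
      have ht2 : t = 0 := by omega
      subst ht2
      have hq1 : q = 1 := by omega
      subst hq1
      push_cast at h5 h6 hsq hβ'
      have hcub : β ^ 3 = 8 * β - 3 := by linear_combination (β + 3) * hsq
      have hnn : 0 ≤ β ^ 2 - 1 := by linarith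
      rcases le_or_gt (-2) p with hp | hp
      · have hp' : (-2 : ℝ) ≤ p := by exact_mod_cast hp
        have : (β ^ 2 - 1) * (-2 + 1 * β) ≤ (β ^ 2 - 1) * (p + 1 * β) := by
          apply mul_le_mul_of_nonneg_left _ hnn
          linarith
        linarith
      · have hp' : (p : ℝ) ≤ -3 := by exact_mod_cast (by omega : p ≤ -3)
        have : (β ^ 2 - 1) * (p + 1 * β') ≤ (β ^ 2 - 1) * (-3 + 1 * β') := by
          apply mul_le_mul_of_nonneg_left _ hnn
          linarith
        rw [hβ'] at this h6
        linarith
    · have hp0 : p = 0 := by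
        by_contra hne
        have hp1 : (1 : ℝ) ≤ p := by exact_mod_cast (by omega : 1 ≤ p)
        simp only [Int.cast_zero, zero_mul, add_zero] at h5
        have : β ^ 2 - 1 ≤ (β ^ 2 - 1) * p := by
          have : 0 < β ^ 2 - 1 := by nlinarith only [hb]
          exact le_mul_of_one_le_right this.le hp1
        have h20 : t * β + s ≤ (m - 1) * β := by
          have : (s : ℝ) ≤ s * β := le_mul_of_one_le_right hs0 hb.le
          rw [← h3']; linarith
        linarith
      subst hp0
      have : latticeValue β ((0 : ℤ), (0 : ℤ)) = 0 := map_zero _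
      rw [this]
      exact h0 s t h1 h2
/-- The base case for the base `-β`, with `β` of norm minus one. -/
theorem core_mem_of_neg_one_neg_one (h : IsQuadraticUnitPair β β' m ε) (hs : 0 ≤ s) (ht : 0 ≤ t)
    (hst : ε = -1 ∧ s + t = m) (v : ℤ × ℤ)
    (hv : |latticeValue β v - (s - t) / (2 * ((-1 : ℤ) * β - 1))| ≤ (s + t) / (2 * (β - 1)))
    (hv' : |latticeValue β' v - windowCenter ((-1 : ℤ) * β') s t| < windowRadius β s t) :
    latticeValue β v ∈ digitSpectrum (Finset.Icc (-s) t) ((-1 : ℤ) * β) := by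
  have hb := h.one_lt
  have hβ' : β' = m - β := by linarith [h.add_eq]
  have hconj := h.conj_eq
  have hbp : 0 < β := by linarith
  have n1 : β - 1 ≠ 0 := by linarith
  have n2 : β ≠ 0 := by linarith
  have n3 : β + 1 ≠ 0 := by linarith
  have hv : -((s : ℝ) * β + t) ≤ (β ^ 2 - 1) * latticeValue β v ∧
      (β ^ 2 - 1) * latticeValue β v ≤ t * β + s := by
    apply mul_bounds_of_abs_sub_le_add hb
    rw [add_comm (t : ℝ)]
    convert hv using 3
    push_cast
    rw [show (-1 : ℝ) * β - 1 = -(β + 1) by ring]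
    field_simp
    ring
  have h0 : ∀ s t : ℤ, 0 ≤ s → 0 ≤ t →
      (0 : ℝ) ∈ digitSpectrum (Finset.Icc (-s) t) ((-1 : ℤ) * β) := fun s t hs ht =>
    zero_mem_digitSpectrum (by rw [Finset.mem_Icc]; omega)
  obtain ⟨rfl, hst⟩ := hst
  obtain ⟨hm, hm1, hm2, hsq, hprod⟩ := h.bounds_of_neg_one
  have hm0 : (1 : ℝ) ≤ m := by exact_mod_cast hm
  have hw : -(s : ℝ) < (β - 1) * (latticeValue β' v / β) ∧
      (β - 1) * (latticeValue β' v / β) < t := by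
    apply mul_bounds_of_abs_sub_lt_sub hb
    have e1 : latticeValue β' v / β - ((t : ℝ) - s) / (2 * (β - 1)) =
        (latticeValue β' v - windowCenter ((-1 : ℤ) * β') s t) / β := by
      rw [windowCenter, hconj]
      push_cast
      have e3 : 1 - -1 * (-1 / β) = (β - 1) / β := by field_simp
      rw [e3]
      field_simp
    have e2 : ((t : ℝ) + s) / (2 * (β - 1)) = windowRadius β s t / β := by
      rw [windowRadius]; field_simp; ring
    rw [e1, e2, abs_div, abs_of_pos hbp]
    gcongr
  refine core_neg (P := fun s t v => 0 ≤ s ∧ 0 ≤ t ∧ s + t = m ∧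
    (-((s : ℝ) * β + t) ≤ (β ^ 2 - 1) * latticeValue β v ∧
      (β ^ 2 - 1) * latticeValue β v ≤ t * β + s) ∧
    (-(s : ℝ) < (β - 1) * (latticeValue β' v / β) ∧
      (β - 1) * (latticeValue β' v / β) < t)) ?_ ?_ ⟨hs, ht, hst, hv, hw⟩
  · rintro s t v ⟨h1, h2, h3, ⟨h4, h5⟩, h6, h7⟩
    simp only [map_neg, neg_div, mul_neg]
    exact ⟨h2, h1, by omega, ⟨by linarith, by linarith⟩, by linarith, by linarith⟩
  · rintro s t p q ⟨h1, h2, h3, ⟨-, h5⟩, h6, -⟩ hpq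
    have hs0 : (0 : ℝ) ≤ s := by exact_mod_cast h1
    have ht0 : (0 : ℝ) ≤ t := by exact_mod_cast h2
    have h3' : (s : ℝ) + t = m := by exact_mod_cast h3
    have ht' : (t : ℝ) = m - s := by linarith
    rw [latticeValue_apply] at h5 h6
    simp only at h5 h6
    have e : β ^ 2 - 1 = m * β := by linear_combination hsq
    have h7 : m * β * (p + q * β) ≤ t * β + s := by rw [← e]; exact h5
    have h8 : -(s * (β + 1)) < m * (p + q * β') := by
      have h9 : -(s : ℝ) * (β + 1) < (β - 1) * ((p + q * β') / β) * (β + 1) := by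
        gcongr
      have e2 : (β - 1) * ((p + q * β') / β) * (β + 1) = m * (p + q * β') := by
        have : (β - 1) * ((p + q * β') / β) * (β + 1) =
          (β ^ 2 - 1) * ((p + q * β') / β) := by ring
        rw [this, e]; field_simp
      linarith
    rcases hpq with hq | ⟨rfl, hp⟩
    · have hq' : (1 : ℝ) ≤ q := by exact_mod_cast hq
      have h9 : (m * q - s) * (β ^ 2 + 1) < m * β := by
        have e2 : β * (β - β') = β ^ 2 + 1 := by rw [hβ']; linear_combination hsq
        have : β * (-(s * (β + 1))) < β * (m * (p + q * β')) :=
          mul_lt_mul_of_pos_left h8 hbp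
        have e3 : m * q * (β ^ 2 + 1) = m * β * (p + q * β) - β * (m * (p + q * β')) := by
          rw [← e2]; ring
        rw [ht'] at h7
        nlinarith
      have h10 : m * q - s ≤ 0 := by
        by_contra hne
        have : (1 : ℝ) ≤ m * q - s := by exact_mod_cast (by omega : 1 ≤ m * q - s)
        nlinarith
      have hq1 : q = 1 := by
        by_contra hne
        have : 2 ≤ q := by omega
        nlinarith
      subst hq1
      have hsm : s = m := by omega
      have htm : t = 0 := by omega
      subst hsm htm
      push_cast at h7 h8
      have hp1 : p ≤ -s := by
        by_contra hne
        have hp1 : (1 : ℝ) - s ≤ p := by exact_mod_cast (by omega : 1 - s ≤ p)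
        have h11 : β * (p + 1 * β) ≤ 1 := by
          have : s * (β * (p + 1 * β)) ≤ s * 1 := by linarith
          exact le_of_mul_le_mul_left this (by linarith)
        nlinarith
      have hp2 : -s ≤ p := by
        by_contra hne
        have hp2 : (p : ℝ) ≤ -s - 1 := by exact_mod_cast (by omega : p ≤ -s - 1)
        have h11 : -(β + 1) < p + 1 * β' := by
          have : s * (-(β + 1)) < s * (p + 1 * β') := by linarith
          exact lt_of_mul_lt_mul_left this (by linarith)
        rw [hβ'] at h11
        linarith
      have hp3 : p = -s := by omega
      subst hp3
      -- The only surviving point off the integers is `β - s = -s + (-β) * (-1)`, with digits `-s`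
      -- and `-1`.
      have h11 := add_mul_mem_digitSpectrum (α := (-1 : ℤ) * β) (x := ((-1 : ℤ) : ℝ))
        (show -s ∈ Finset.Icc (-s) 0 by rw [Finset.mem_Icc]; omega)
        (intCast_mem_digitSpectrum (by rw [Finset.mem_Icc]; omega)
          (by rw [Finset.mem_Icc]; omega))
      rw [latticeValue_apply]
      convert h11 using 1
      push_cast; ring
    · have hp1 : p ≤ t := by
        by_contra hne
        have hp1 : (t : ℝ) + 1 ≤ p := by exact_mod_cast (by omega : t + 1 ≤ p)
        simp only [Int.cast_zero, zero_mul, add_zero] at h7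
        have : m * β * (t + 1) ≤ m * β * p := by
          apply mul_le_mul_of_nonneg_left hp1; positivity
        have h12 : m * β * t ≥ t * β := by
          have : 0 ≤ (m - 1) * (t * β) := mul_nonneg (by linarith) (by positivity)
          linarith
        nlinarith
      rw [latticeValue_apply]
      have := intCast_mem_digitSpectrum (α := (-1 : ℤ) * β) (A := Finset.Icc (-s) t) (a := p)
        (by rw [Finset.mem_Icc]; omega) (by rw [Finset.mem_Icc]; omega)
      simpa using this

end IsQuadraticUnitPair

/-! ### The spectrum contains the lattice points in the window. -/

namespace IsQuadraticUnitPair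

variable {β β' : ℝ} {m ε σ s t : ℤ}

/-- Two-sided case: the spectrum contains all lattice points with conjugate in the open window. -/
theorem mem_digitSpectrum_of_twoSided (h : IsQuadraticUnitPair β β' m ε) (hσ : σ = 1 ∨ σ = -1)
    (hs : 0 ≤ s) (ht : 0 ≤ t) (hst : β < s + t + 1) (hcase : σ = -1 ∨ (1 ≤ s ∧ 1 ≤ t))
    {v : ℤ × ℤ} (hv : |latticeValue β' v - windowCenter (σ * β') s t| < windowRadius β s t) :
    latticeValue β v ∈ digitSpectrum (Finset.Icc (-s) t) (σ * β) := by
  have hb := h.one_lt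
  -- The digits are cut down to a set covered by a base case: `s₀ + t₀` is `m - 1` for norm one and
  -- `m` for norm minus one, except that base `β` with `m = 1` uses `s₀ = t₀ = 1`. The window is
  -- then enlarged again to that of all digits.
  obtain ⟨s₀, t₀, hs0, ht0, hss, htt, hst0, hcore⟩ : ∃ s₀ t₀ : ℤ, 0 ≤ s₀ ∧ 0 ≤ t₀ ∧ s₀ ≤ s ∧
      t₀ ≤ t ∧ β < s₀ + t₀ + 1 ∧
      ∀ v, |latticeValue β v - (s₀ - t₀) / (2 * (σ * β - 1))| ≤ (s₀ + t₀) / (2 * (β - 1)) →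
      |latticeValue β' v - windowCenter (σ * β') s₀ t₀| < windowRadius β s₀ t₀ →
      latticeValue β v ∈ digitSpectrum (Finset.Icc (-s₀) t₀) (σ * β) := by
    rcases h.sign with rfl | rfl
    · obtain ⟨hm, hm1, hm2, -, -⟩ := h.bounds_of_one
      have hstm : m - 1 ≤ s + t := by
        have : (m : ℝ) - 1 < s + t + 1 := by linarith
        have : m - 1 < s + t + 1 := by exact_mod_cast this
        omega
      rcases hcase with rfl | ⟨h1, h2⟩
      · have hsum : (min s (m - 1)) + (m - 1 - min s (m - 1)) = m - 1 := by ring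
        refine ⟨min s (m - 1), m - 1 - min s (m - 1), by omega, by omega, by omega, by omega, ?_,
          h.core_mem_of_neg_one_one (by omega) (by omega) ⟨rfl, hsum⟩⟩
        push_cast; linarith
      · have hsum : (min s (m - 2)) + (m - 1 - min s (m - 2)) = m - 1 := by ring
        rcases hσ with rfl | rfl
        · refine ⟨min s (m - 2), m - 1 - min s (m - 2), by omega, by omega, by omega, by omega, ?_,
            h.core_mem_of_one_one (by omega) (by omega) ⟨rfl, hsum⟩⟩
          push_cast; linarith
        · refine ⟨min s (m - 2), m - 1 - min s (m - 2), by omega, by omega, by omega, by omega, ?_,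
            h.core_mem_of_neg_one_one (by omega) (by omega) ⟨rfl, hsum⟩⟩
          push_cast; linarith
    · obtain ⟨hm, hm1, hm2, -, -⟩ := h.bounds_of_neg_one
      have hstm : m ≤ s + t := by
        have : (m : ℝ) < s + t + 1 := by linarith
        have : m < s + t + 1 := by exact_mod_cast this
        omega
      by_cases hσ' : σ = -1
      · subst hσ'
        have hsum : (min s m) + (m - min s m) = m := by ring
        refine ⟨min s m, m - min s m, by omega, by omega, by omega, by omega, ?_,
          h.core_mem_of_neg_one_neg_one (by omega) (by omega) ⟨rfl, hsum⟩⟩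
        push_cast; linarith
      · obtain ⟨h1, h2⟩ := hcase.resolve_left hσ'
        obtain rfl := hσ.resolve_right hσ'
        by_cases hm1' : m = 1
        · subst hm1'
          refine ⟨1, 1, by omega, by omega, by omega, by omega, ?_,
            h.core_mem_of_one_neg_one le_rfl le_rfl (Or.inr ⟨rfl, rfl, rfl, rfl⟩)⟩
          push_cast at hm2 ⊢; linarith
        · have hsum : (min s (m - 1)) + (m - min s (m - 1)) = m := by ring
          refine ⟨min s (m - 1), m - min s (m - 1), by omega, by omega, by omega, by omega, ?_,
            h.core_mem_of_one_neg_one (by omega) (by omega) (Or.inl ⟨rfl, hsum⟩)⟩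
          push_cast; linarith
  have hbase := fun v => h.mem_digitSpectrum_of_core hσ hs0 ht0 hst0 hcore v
  obtain ⟨M, hM⟩ := h.mem_digitSpectrum_of_window hσ hs ht hst (one := False) (by simp)
    (M₀ := 0) (lt_windowRadius hb hst0)
    (fun v _ hv => digitSpectrum_mono (Finset.Icc_subset_Icc (by omega) htt) (hbase v hv))
    (δ := windowRadius β s t - |latticeValue β' v - windowCenter (σ * β') s t|) (by linarith)
  exact hM v (fun h => h.elim) (by linarith)

/-- A lattice point with nonnegative value reaches zero by division steps that preserve the
nonnegativity and the window. -/
theorem mem_digitSpectrum_of_descent (h : IsQuadraticUnitPair β β' m ε) (ht : 0 ≤ t)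
    {W : Set ℝ} {C : ℝ} (hW : ∀ x ∈ W, |x| ≤ C)
    (hstep : ∀ v, 0 ≤ latticeValue β v → latticeValue β' v ∈ W →
      ∃ a : ℤ, 0 ≤ a ∧ a ≤ t ∧ (a : ℝ) ≤ latticeValue β v ∧
        ∃ v', latticeValue β v = a + β * latticeValue β v' ∧ latticeValue β' v' ∈ W)
    (v : ℤ × ℤ) (hv : 0 ≤ latticeValue β v) (hv' : latticeValue β' v ∈ W) :
    latticeValue β v ∈ digitSpectrum (Finset.Icc 0 t) β := by
  by_contra hcon
  have hb := h.one_lt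
  obtain ⟨w, ⟨hw1, hw2, hw3, hw4⟩, hmin⟩ := Set.exists_min_image
    {w | 0 ≤ latticeValue β w ∧ latticeValue β w ≤ latticeValue β v ∧ latticeValue β' w ∈ W ∧
      latticeValue β w ∉ digitSpectrum (Finset.Icc 0 t) β} (fun w => latticeValue β w)
    ((h.finite_bounded (latticeValue β v) C).subset (by
      rintro w ⟨h1, h2, h3, -⟩
      exact ⟨abs_le.2 ⟨by linarith, h2⟩, hW _ h3⟩)) ⟨v, hv, le_rfl, hv', hcon⟩
  obtain ⟨a, ha0, hat, haw, w', h1, h2⟩ := hstep w hw1 hw3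
  -- A digit not exceeding the value leaves a nonnegative quotient, which is smaller than the
  -- original unless it is zero.
  have hw'0 : 0 ≤ latticeValue β w' := by
    by_contra hneg
    nlinarith
  have ha0' : (0 : ℝ) ≤ a := by exact_mod_cast ha0
  have hw'mem : latticeValue β w' ∉ digitSpectrum (Finset.Icc 0 t) β := fun hmem =>
    hw4 (h1 ▸ add_mul_mem_digitSpectrum (Finset.mem_Icc.2 ⟨ha0, hat⟩) hmem)
  have hwpos : 0 < latticeValue β w' := by
    rcases hw'0.lt_or_eq with h3 | h3
    · exact h3
    · exact absurd (h3 ▸ zero_mem_digitSpectrum (Finset.mem_Icc.2 ⟨le_rfl, ht⟩)) hw'mem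
  have hlt : latticeValue β w' < latticeValue β w := by nlinarith
  have := hmin w' ⟨hw'0, hlt.le.trans hw2, h2, hw'mem⟩
  linarith

/-- On conjugates the step is `y ↦ β (y - a)`, so `a = ⌊y⌋` preserves `[0, β)`. If `a` exceeded the
value, then `q = -1` and `p = a + 1 = m` would follow, and the conjugate would be `m - β' = β`,
outside the half-open window. -/
theorem exists_oneSided_digit_of_one (h : IsQuadraticUnitPair β β' m 1) (hst : β < t + 1)
    (v : ℤ × ℤ) (hv : 0 ≤ latticeValue β v) (hv' : latticeValue β' v ∈ Set.Ico 0 β) :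
    ∃ a : ℤ, 0 ≤ a ∧ a ≤ t ∧ (a : ℝ) ≤ latticeValue β v ∧
      ∃ v', latticeValue β v = a + β * latticeValue β v' ∧
        latticeValue β' v' ∈ Set.Ico 0 β := by
  have hb := h.one_lt
  obtain ⟨hm, hm1, hm2, hsq, hprod⟩ := h.bounds_of_one
  have hm3 : (3 : ℝ) ≤ m := by exact_mod_cast hm
  have hβ' : β' = m - β := by linarith [h.add_eq]
  have hββ' : β * β' = 1 := by simpa using h.mul_eq
  have hβ'0 : 0 < β' := by rw [hβ']; linarith
  obtain ⟨hv1, hv2⟩ := hv'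
  set a := ⌊latticeValue β' v⌋ with ha
  have ha0 : 0 ≤ a := Int.floor_nonneg.2 hv1
  have ha1 : (a : ℝ) ≤ latticeValue β' v := Int.floor_le _
  have ha2 : latticeValue β' v < a + 1 := Int.lt_floor_add_one _
  have ham : a ≤ m - 1 := by
    have : (a : ℝ) < m := by linarith
    have : a < m := by exact_mod_cast this
    omega
  have hmt : m - 1 ≤ t := by
    have : (m : ℝ) - 1 < t + 1 := by linarith
    have : m - 1 < t + 1 := by exact_mod_cast this
    omega
  refine ⟨a, ha0, by omega, ?_, ?_⟩
  · by_contra hlt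
    push Not at hlt
    clear_value a
    obtain ⟨p, q⟩ := v
    rw [latticeValue_apply] at *
    simp only at *
    have ham' : (a : ℝ) ≤ m - 1 := by exact_mod_cast ham
    have hd : β - β' = m - 2 * β' := by rw [hβ']; ring
    have hβ'1 : β' < 1 := by rw [hβ']; linarith
    have hq1 : 1 ≤ -q := by
      by_contra hne
      have : (0 : ℝ) ≤ q := by exact_mod_cast (by omega : 0 ≤ q)
      have : 0 ≤ q * (β - β') := mul_nonneg this (by linarith)
      linarith
    have hq2 : -q ≤ 1 := by
      by_contra hne
      have hq3 : (2 : ℝ) ≤ -q := by exact_mod_cast (by omega : 2 ≤ -q)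
      have h5 : 2 * (β - β') ≤ -q * (β - β') := mul_le_mul_of_nonneg_right hq3 (by linarith)
      have h6 : β' * 2 < 1 := by
        have : 2 * β' < β * β' := mul_lt_mul_of_pos_right (by linarith) hβ'0
        linarith
      linarith
    have hq : q = -1 := by omega
    subst hq
    push_cast at *
    have hp : p = a + 1 := by
      have h5 : (a : ℝ) < p := by linarith
      have h6 : (p : ℝ) < a + 2 := by linarith
      have h7 : a < p := by exact_mod_cast h5
      have h8 : p < a + 2 := by exact_mod_cast h6
      omega
    subst hp
    push_cast at *
    have h9 : m - 2 < a := by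
      have : (m : ℝ) - 2 < a := by linarith
      exact_mod_cast this
    have h10 : a = m - 1 := by omega
    rw [h10] at hv2
    push_cast at hv2
    linarith
  · obtain ⟨v', h1, h2⟩ := h.exists_digit (σ := 1) (Or.inl rfl) v a
    rw [Int.cast_one, one_mul] at h1 h2
    have h3 : latticeValue β' v' = β * (latticeValue β' v - a) := by
      rw [h2]; linear_combination (-latticeValue β' v') * hββ'
    refine ⟨v', h1, ?_, ?_⟩
    · rw [h3]; exact mul_nonneg (by linarith) (by linarith)
    · rw [h3]
      have : β * (latticeValue β' v - a) < β * 1 :=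
        mul_lt_mul_of_pos_left (by linarith) (by linarith)
      linarith

/-- On conjugates the step is `y ↦ -β (y - a)`, and `(-1, β)` is preserved when `-1 < y - a < -β' =
1 / β`. The least such digit is taken: were it larger than the value, then `q = 0` and the integer
`p` would lie strictly between `a - 1` and `a`. -/
theorem exists_oneSided_digit_of_neg_one (h : IsQuadraticUnitPair β β' m (-1)) (hst : β < t + 1)
    (v : ℤ × ℤ) (hv : 0 ≤ latticeValue β v) (hv' : latticeValue β' v ∈ Set.Ioo (-1) β) :
    ∃ a : ℤ, 0 ≤ a ∧ a ≤ t ∧ (a : ℝ) ≤ latticeValue β v ∧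
      ∃ v', latticeValue β v = a + β * latticeValue β v' ∧
        latticeValue β' v' ∈ Set.Ioo (-1) β := by
  have hb := h.one_lt
  obtain ⟨hm, hm1, hm2, hsq, hprod⟩ := h.bounds_of_neg_one
  have hm3 : (1 : ℝ) ≤ m := by exact_mod_cast hm
  have hβ' : β' = m - β := by linarith [h.add_eq]
  have hββ' : β * β' = -1 := by simpa using h.mul_eq
  obtain ⟨hv1, hv2⟩ := hv'
  have hmt : m ≤ t := by
    have : (m : ℝ) < t + 1 := by linarith
    have : m < t + 1 := by exact_mod_cast this
    omega
  obtain ⟨a, ha0, ham, halo, hahi, hamin⟩ : ∃ a : ℤ, 0 ≤ a ∧ a ≤ m ∧ latticeValue β' v < a - β' ∧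
      (a : ℝ) - 1 < latticeValue β' v ∧ (1 ≤ a → (a : ℝ) - 1 - β' ≤ latticeValue β' v) := by
    have h1 := Int.lt_floor_add_one (latticeValue β' v + β')
    have h2 := Int.floor_le (latticeValue β' v + β')
    rcases le_or_gt 0 ⌊latticeValue β' v + β'⌋ with h3 | h3
    · refine ⟨⌊latticeValue β' v + β'⌋ + 1, by omega, ?_, ?_, ?_, ?_⟩
      · have : (⌊latticeValue β' v + β'⌋ : ℝ) < m := by linarith
        have : ⌊latticeValue β' v + β'⌋ < m := by exact_mod_cast this
        omega
      · push_cast; linarith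
      · push_cast; linarith
      · push_cast; intro; linarith
    · refine ⟨0, le_rfl, by omega, ?_, ?_, by omega⟩
      · have h4 : ((⌊latticeValue β' v + β'⌋ : ℤ) : ℝ) ≤ -1 := by exact_mod_cast (by omega)
        push_cast; linarith
      · push_cast; linarith
  refine ⟨a, ha0, by omega, ?_, ?_⟩
  · by_contra hlt
    push Not at hlt
    have ha1 : 1 ≤ a := by
      by_contra hne
      have : a = 0 := by omega
      subst this
      push_cast at hlt
      linarith
    have hamin := hamin ha1
    obtain ⟨p, q⟩ := v
    rw [latticeValue_apply] at *
    simp only at *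
    have ham' : (a : ℝ) ≤ m := by exact_mod_cast ham
    have hq1 : q ≤ 0 := by
      by_contra hne
      have hq2 : (1 : ℝ) ≤ q := by exact_mod_cast (by omega : 1 ≤ q)
      have : 1 * (β - β') ≤ q * (β - β') := mul_le_mul_of_nonneg_right hq2 (by linarith)
      linarith
    have hq3 : 0 ≤ q := by
      by_contra hne
      have hq2 : (1 : ℝ) ≤ -q := by exact_mod_cast (by omega : 1 ≤ -q)
      have : 1 * (β - β') ≤ -q * (β - β') := mul_le_mul_of_nonneg_right hq2 (by linarith)
      linarith
    have hq : q = 0 := by omega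
    subst hq
    simp only [Int.cast_zero, zero_mul, add_zero] at *
    have h5 : p < a := by exact_mod_cast hlt
    have h6 : (a : ℝ) - 1 < p := by linarith
    have h7 : a - 1 < p := by exact_mod_cast h6
    omega
  · obtain ⟨v', h1, h2⟩ := h.exists_digit (σ := 1) (Or.inl rfl) v a
    rw [Int.cast_one, one_mul] at h1 h2
    have h3 : latticeValue β' v' = -(β * (latticeValue β' v - a)) := by
      rw [h2]; linear_combination latticeValue β' v' * hββ'
    refine ⟨v', h1, ?_, ?_⟩
    · rw [h3]
      have : β * (latticeValue β' v - a) < β * (-β') :=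
        mul_lt_mul_of_pos_left (by linarith) (by linarith)
      linarith
    · rw [h3]
      have : β * (-1) < β * (latticeValue β' v - a) :=
        mul_lt_mul_of_pos_left (by linarith) (by linarith)
      linarith

/-- One-sided case: far out, the spectrum contains all lattice points with conjugate in a given
window strictly inside the maximal one. -/
theorem mem_digitSpectrum_of_oneSided (h : IsQuadraticUnitPair β β' m ε) (ht : 0 ≤ t)
    (hst : β < t + 1) {δ : ℝ} (hδ : 0 < δ) :
    ∃ M : ℝ, ∀ v, M ≤ latticeValue β v →
      |latticeValue β' v - windowCenter β' 0 t| ≤ windowRadius β 0 t - δ →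
      latticeValue β v ∈ digitSpectrum (Finset.Icc 0 t) β := by
  have hb := h.one_lt
  obtain ⟨k₀, R₀, M₀, hR₀, hwin⟩ : ∃ k₀ R₀ M₀ : ℝ, β / 2 < R₀ ∧ ∀ v, M₀ ≤ latticeValue β v →
      |latticeValue β' v - k₀| < R₀ → latticeValue β v ∈ digitSpectrum (Finset.Icc 0 t) β := by
    rcases h.sign with rfl | rfl
    -- The descent window `[0, β)` has length exactly `β`, which is not enough. One preliminary
    -- digit `⌊y⌋ ≤ t` extends it to `(0, t + 1)`; values of at least `t + 1` keep the quotient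
    -- nonnegative.
    · refine ⟨(t + 1) / 2, (t + 1) / 2, t + 1, by linarith, fun v hv1 hv2 => ?_⟩
      rw [abs_lt] at hv2
      set a := ⌊latticeValue β' v⌋ with ha
      have ha0 : 0 ≤ a := Int.floor_nonneg.2 (by linarith)
      have ha1 : (a : ℝ) ≤ latticeValue β' v := Int.floor_le _
      have ha2 : latticeValue β' v < a + 1 := Int.lt_floor_add_one _
      have hat : a ≤ t := by
        have : (a : ℝ) < t + 1 := by linarith
        have : a < t + 1 := by exact_mod_cast this
        omega
      have hat' : (a : ℝ) ≤ t := by exact_mod_cast hat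
      have hββ' : β * β' = 1 := by simpa using h.mul_eq
      obtain ⟨v', h1, h2⟩ := h.exists_digit (σ := 1) (Or.inl rfl) v a
      rw [Int.cast_one, one_mul] at h1 h2
      have h3 : latticeValue β' v' = β * (latticeValue β' v - a) := by
        rw [h2]; linear_combination (-latticeValue β' v') * hββ'
      rw [h1]
      apply add_mul_mem_digitSpectrum (Finset.mem_Icc.2 ⟨ha0, hat⟩)
      refine h.mem_digitSpectrum_of_descent ht (W := Set.Ico 0 β) (C := β) ?_
        (h.exists_oneSided_digit_of_one hst) v' ?_ ⟨?_, ?_⟩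
      · rintro x ⟨hx1, hx2⟩
        rw [abs_of_nonneg hx1]; exact hx2.le
      · by_contra hneg
        nlinarith
      · rw [h3]; exact mul_nonneg (by linarith) (by linarith)
      · rw [h3]
        have : β * (latticeValue β' v - a) < β * 1 :=
          mul_lt_mul_of_pos_left (by linarith) (by linarith)
        linarith
    -- The descent window `(-1, β)` is already longer than `β`.
    · refine ⟨(β - 1) / 2, (β + 1) / 2, 0, by linarith, fun v hv1 hv2 => ?_⟩
      rw [abs_lt] at hv2
      refine h.mem_digitSpectrum_of_descent ht (W := Set.Ioo (-1) β) (C := β) ?_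
        (h.exists_oneSided_digit_of_neg_one hst) v hv1 ⟨by linarith, by linarith⟩
      rintro x ⟨hx1, hx2⟩
      rw [abs_le]; constructor <;> linarith
  obtain ⟨M, hM⟩ := h.mem_digitSpectrum_of_window (σ := 1) (s := 0) (Or.inl rfl) le_rfl ht
    (by push_cast; linarith) (one := True) (fun _ => rfl) (k₀ := k₀) (R₀ := R₀) (M₀ := M₀) hR₀
    (fun v hv1 hv2 => by simpa using hwin v (hv1 trivial) hv2) hδ
  refine ⟨M, fun v hv1 hv2 => ?_⟩
  have := hM v (fun _ => hv1) (by simpa using hv2)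
  simpa using this

end IsQuadraticUnitPair

/-! ### Monotone enumeration of locally finite sets of reals. -/

section Enumeration

variable {X : Set ℝ}

theorem exists_strictMono_int_range_eq (hfin : ∀ a b, (X ∩ Set.Icc a b).Finite)
    (hup : ∀ B, ∃ x ∈ X, B < x) (hdown : ∀ B, ∃ x ∈ X, x < B) :
    ∃ y : ℤ → ℝ, StrictMono y ∧ Set.range y = X := by
  have hIcc : ∀ a b : X, (Set.Icc a b).Finite := by
    intro a b
    refine Set.Finite.of_finite_image ((hfin a b).subset ?_) Subtype.val_injective.injOn
    rintro _ ⟨x, hx, rfl⟩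
    exact ⟨x.2, hx⟩
  let _ : LocallyFiniteOrder X := LocallyFiniteOrder.ofFiniteIcc hIcc
  let _ : SuccOrder X := LinearLocallyFiniteOrder.succOrder X
  let _ : PredOrder X := LinearLocallyFiniteOrder.predOrder X
  have : NoMaxOrder X := ⟨fun a => by
    obtain ⟨x, hx, hlt⟩ := hup a
    exact ⟨⟨x, hx⟩, hlt⟩⟩
  have : NoMinOrder X := ⟨fun a => by
    obtain ⟨x, hx, hlt⟩ := hdown a
    exact ⟨⟨x, hx⟩, hlt⟩⟩
  have : Nonempty X := by
    obtain ⟨x, hx, -⟩ := hup 0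
    exact ⟨⟨x, hx⟩⟩
  let e : X ≃o ℤ := orderIsoIntOfLinearSuccPredArch
  refine ⟨fun n => (e.symm n : ℝ), fun a b hab => e.symm.strictMono hab, ?_⟩
  ext x
  constructor
  · rintro ⟨n, rfl⟩
    exact (e.symm n).2
  · intro hx
    exact ⟨e ⟨x, hx⟩, by simp⟩

theorem exists_strictMono_nat_range_eq (hfin : ∀ a b, (X ∩ Set.Icc a b).Finite)
    (hup : ∀ B, ∃ x ∈ X, B < x) {x₀ : ℝ} (hx₀ : x₀ ∈ X) (hmin : ∀ x ∈ X, x₀ ≤ x) :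
    ∃ y : ℕ → ℝ, StrictMono y ∧ Set.range y = X := by
  have hIcc : ∀ a b : X, (Set.Icc a b).Finite := by
    intro a b
    refine Set.Finite.of_finite_image ((hfin a b).subset ?_) Subtype.val_injective.injOn
    rintro _ ⟨x, hx, rfl⟩
    exact ⟨x.2, hx⟩
  let _ : LocallyFiniteOrder X := LocallyFiniteOrder.ofFiniteIcc hIcc
  let _ : SuccOrder X := LinearLocallyFiniteOrder.succOrder X
  let _ : PredOrder X := LinearLocallyFiniteOrder.predOrder X
  have : NoMaxOrder X := ⟨fun a => by
    obtain ⟨x, hx, hlt⟩ := hup a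
    exact ⟨⟨x, hx⟩, hlt⟩⟩
  let _ : OrderBot X := { bot := ⟨x₀, hx₀⟩, bot_le := fun x => hmin x x.2 }
  let e : X ≃o ℕ := orderIsoNatOfLinearSuccPredArch
  refine ⟨fun n => (e.symm n : ℝ), fun a b hab => e.symm.strictMono hab, ?_⟩
  ext x
  constructor
  · rintro ⟨n, rfl⟩
    exact (e.symm n).2
  · intro hx
    exact ⟨e ⟨x, hx⟩, by simp⟩

end Enumeration

/-! ### The spectrum as a model set: gaps and frequencies. -/

namespace IsQuadraticUnitPair

variable {β β' : ℝ} {m ε σ s t : ℤ} {l j : ℕ}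

/-- `1` and `j - β' = j - m + β` form a basis of `ℤ[β]`, and so do their quotients by the unit `β ^
l`. As `β' ^ (-l) = ε ^ l β ^ l`, the factor `ε ^ l` in the internal projection makes the conjugate
of `u` positive. -/
theorem exists_isWindowBasis (h : IsQuadraticUnitPair β β' m ε) {R : ℝ} (hj : 1 ≤ j) (hjβ : j < β)
    (hP : β ^ l < 2 * R) (hQ : β ^ l * (β - j) < 2 * R)
    (hle : 2 * R ≤ β ^ l + β ^ l * (β - j)) :
    ∃ u w, IsWindowBasis (latticeValue β)
        ((AddMonoidHom.mulLeft ((ε : ℝ) ^ l)).comp (latticeValue β')) u w R ∧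
      latticeValue β u = 1 / β ^ l ∧ latticeValue β w = 1 / β ^ l * (j - β') ∧
      (ε : ℝ) ^ l * latticeValue β' u = β ^ l ∧
      (ε : ℝ) ^ l * latticeValue β' w = -(β ^ l * (β - j)) := by
  have hb := h.one_lt
  have hadd := h.add_eq
  have hβ'1 : β' < 1 := by
    have h1 := h.abs_conj
    have h2 := le_abs_self β'
    have h3 : 1 / β < 1 := by rw [div_lt_one (by linarith)]; exact hb
    linarith
  have hpow : 0 < β ^ l := by positivity
  have hj' : (1 : ℝ) ≤ j := by exact_mod_cast hj
  obtain ⟨u, hu, hu'⟩ := h.exists_inv_pow_mul l (1, 0)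
  obtain ⟨w, hw, hw'⟩ := h.exists_inv_pow_mul l (j - m, 1)
  have hconj : ∀ x : ℝ, (ε : ℝ) ^ l * x = β ^ l * (β' ^ l * x) := by
    intro x
    rw [← mul_assoc, ← mul_pow, h.mul_eq]
  have e1 : ∀ θ : ℝ, latticeValue θ (1, 0) = 1 := fun θ => by simp [latticeValue_apply]
  have e2 : ∀ θ : ℝ, latticeValue θ ((j : ℤ) - m, 1) = j - m + θ := fun θ => by
    simp [latticeValue_apply]
  rw [e1] at hu hu'
  rw [e2] at hw hw'
  have eu : latticeValue β u = 1 / β ^ l := by rw [eq_div_iff hpow.ne']; linarith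
  have ew : latticeValue β w = 1 / β ^ l * (j - β') := by
    rw [one_div_mul_eq_div, eq_div_iff hpow.ne']; linarith
  have eu' : (ε : ℝ) ^ l * latticeValue β' u = β ^ l := by rw [hconj, hu']; ring
  have ew' : (ε : ℝ) ^ l * latticeValue β' w = -(β ^ l * (β - j)) := by
    rw [hconj, hw']; linear_combination β ^ l * hadd
  refine ⟨u, w, ?_, eu, ew, eu', ew'⟩
  have eg : ∀ v, ((AddMonoidHom.mulLeft ((ε : ℝ) ^ l)).comp (latticeValue β')) v =
      (ε : ℝ) ^ l * latticeValue β' v := fun v => rfl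
  refine ⟨h.injective, ?_, ?_, ?_, ?_, ?_, ?_, ?_, ?_, ?_, ?_⟩
  · intro v
    obtain ⟨⟨p, q⟩, hv⟩ := h.exists_pow_mul l v
    refine ⟨p + q * m - q * j, q, h.injective ?_⟩
    rw [map_add, map_zsmul, map_zsmul, eu, ew]
    rw [latticeValue_apply] at hv
    simp only [zsmul_eq_mul]
    have : latticeValue β v = 1 / β ^ l * (p + q * β) := by
      rw [one_div_mul_eq_div, eq_div_iff hpow.ne']; linarith
    rw [this]
    push_cast
    linear_combination (1 / β ^ l * q) * hadd
  · rw [eu]; positivity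
  · rw [ew]
    exact mul_pos (by positivity) (by linarith)
  · rw [eu, ew]
    intro heq
    have h1 : (1 : ℝ) = j - β' := by
      have : 1 / β ^ l * 1 = 1 / β ^ l * (j - β') := by rw [mul_one]; exact heq
      exact mul_left_cancel₀ (by positivity) this
    apply h.irrational
    refine ⟨m + 1 - j, ?_⟩
    push_cast
    linarith
  · rw [eg, eu']; exact hpow
  · rw [eg, ew']
    have : 0 < β ^ l * (β - j) := mul_pos hpow (by linarith)
    linarith
  · rw [eg, eu']; exact hP
  · rw [eg, ew']; linarith
  · rw [eg, eg, eu', ew']; linarith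
  · intro e he
    obtain ⟨v, hv1, hv2⟩ := h.exists_small he
    have hε : (ε : ℝ) ^ l = 1 ∨ (ε : ℝ) ^ l = -1 := by
      rcases h.sign with h1 | h1
      · left; simp [h1]
      · rw [h1]; push_cast; exact neg_one_pow_eq_or ℝ l
    rcases hε with h1 | h1
    · exact ⟨v, by rw [eg, h1, one_mul]; exact hv1, by rw [eg, h1, one_mul]; exact hv2⟩
    · exact ⟨-v, by rw [eg, h1, map_neg]; linarith, by rw [eg, h1, map_neg]; linarith⟩

theorem isModelSet (h : IsQuadraticUnitPair β β' m ε) (hσ : σ = 1 ∨ σ = -1)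
    (hs : 0 ≤ s) (ht : 0 ≤ t) (hst : 0 < s + t)
    (hfull : ∀ δ : ℝ, 0 < δ → ∃ M : ℝ, ∀ v, M ≤ latticeValue β v →
      |latticeValue β' v - windowCenter (σ * β') s t| ≤ windowRadius β s t - δ →
      latticeValue β v ∈ digitSpectrum (Finset.Icc (-s) t) (σ * β)) (l : ℕ) :
    IsModelSet (latticeValue β) ((AddMonoidHom.mulLeft ((ε : ℝ) ^ l)).comp (latticeValue β'))
      {v | latticeValue β v ∈ digitSpectrum (Finset.Icc (-s) t) (σ * β)}
      ((ε : ℝ) ^ l * windowCenter (σ * β') s t) (windowRadius β s t) := by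
  have eg : ∀ v, ((AddMonoidHom.mulLeft ((ε : ℝ) ^ l)).comp (latticeValue β')) v =
      (ε : ℝ) ^ l * latticeValue β' v := fun v => rfl
  have habs : |(ε : ℝ) ^ l| = 1 := by
    rw [abs_pow]
    rcases h.sign with h1 | h1 <;> simp [h1]
  refine ⟨?_, ?_, ?_⟩
  · intro v hv
    rw [eg, ← mul_sub, abs_mul, habs, one_mul]
    exact h.abs_conj_sub_center_le hσ hs ht hv
  · intro v hv v' hv'
    rw [eg, eg, ← mul_sub, abs_mul, habs, one_mul]
    exact h.abs_conj_sub_conj_lt hσ hs ht hst hv hv'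
  · intro δ hδ
    obtain ⟨M, hM⟩ := hfull δ hδ
    refine ⟨M, fun v hv1 hv2 => hM v hv1 ?_⟩
    rw [eg, ← mul_sub, abs_mul, habs, one_mul] at hv2
    exact hv2

/-- The three distances between consecutive points of the spectrum. -/
noncomputable def spectrumGaps (β β' : ℝ) (l j : ℕ) : Fin 3 → ℝ :=
  ![1 / β ^ l, 1 / β ^ l * ((j : ℝ) - β'), 1 / β ^ l * ((j : ℝ) + 1 - β')]

/-- The frequencies of the three distances, for `N + 1` digits. -/
noncomputable def spectrumFrequencies (β : ℝ) (l j : ℕ) (N : ℝ) : Fin 3 → ℝ :=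
  ![1 - β ^ ((l : ℤ) - 1) * (β - 1) / N,
    1 - β ^ ((l : ℤ) - 1) * (β - (j : ℝ)) * (β - 1) / N,
    -1 + β ^ ((l : ℤ) - 1) * (β - (j : ℝ) + 1) * (β - 1) / N]

/-- The hypotheses on `#A - 1 = s + t`, multiplied by `β / (β - 1)`, compare the length of the
window with the conjugates of the basis vectors. -/
theorem window_bounds (hb : 1 < β)
    (hlow : β ^ ((l : ℤ) - 1) * (β - 1) * max (β - (j : ℝ)) 1 < s + t)
    (hup : (s : ℝ) + t ≤ β ^ ((l : ℤ) - 1) * (β - 1) * (β - (j : ℝ) + 1)) :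
    β ^ l < 2 * windowRadius β s t ∧ β ^ l * (β - j) < 2 * windowRadius β s t ∧
      2 * windowRadius β s t ≤ β ^ l + β ^ l * (β - j) := by
  have h1 : 0 < β - 1 := by linarith
  have h2 : 0 < β := by linarith
  have e : β ^ ((l : ℤ) - 1) = β ^ l / β := by
    rw [zpow_sub_one₀ h2.ne', zpow_natCast, div_eq_mul_inv]
  have eR : 2 * windowRadius β s t = (s + t) * (β / (β - 1)) := by
    rw [windowRadius]; field_simp
  have hpos : 0 < β / (β - 1) := by positivity
  have e2 : ∀ x : ℝ, β ^ l * x = β ^ ((l : ℤ) - 1) * (β - 1) * x * (β / (β - 1)) := by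
    intro x; rw [e]; field_simp
  have hc : 0 < β ^ ((l : ℤ) - 1) * (β - 1) := by positivity
  rw [eR]
  refine ⟨?_, ?_, ?_⟩
  · have := e2 1
    rw [mul_one] at this
    rw [this]
    apply mul_lt_mul_of_pos_right _ hpos
    exact (mul_le_mul_of_nonneg_left (le_max_right _ _) hc.le).trans_lt hlow
  · rw [e2]
    apply mul_lt_mul_of_pos_right _ hpos
    exact (mul_le_mul_of_nonneg_left (le_max_left _ _) hc.le).trans_lt hlow
  · have : β ^ l + β ^ l * (β - j) = β ^ l * (β - j + 1) := by ring
    rw [this, e2]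
    exact mul_le_mul_of_nonneg_right hup hpos.le

/-- Gaps and frequencies in an increasing enumeration of an upper part of the spectrum. -/
theorem hasFrequency_spectrum (h : IsQuadraticUnitPair β β' m ε) (hσ : σ = 1 ∨ σ = -1)
    (hs : 0 ≤ s) (ht : 0 ≤ t) (hst : 0 < s + t) (hj : 1 ≤ j) (hjβ : j < β)
    (hlow : β ^ ((l : ℤ) - 1) * (β - 1) * max (β - (j : ℝ)) 1 < s + t)
    (hup : (s : ℝ) + t ≤ β ^ ((l : ℤ) - 1) * (β - 1) * (β - (j : ℝ) + 1))
    (hfull : ∀ δ : ℝ, 0 < δ → ∃ M : ℝ, ∀ v, M ≤ latticeValue β v →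
      |latticeValue β' v - windowCenter (σ * β') s t| ≤ windowRadius β s t - δ →
      latticeValue β v ∈ digitSpectrum (Finset.Icc (-s) t) (σ * β))
    {y : ℕ → ℝ} (hy : StrictMono y)
    (hyX : ∀ n, y n ∈ digitSpectrum (Finset.Icc (-s) t) (σ * β))
    (hXy : ∀ x ∈ digitSpectrum (Finset.Icc (-s) t) (σ * β), y 0 ≤ x → ∃ n, y n = x)
    (htop : Tendsto y atTop atTop) :
    {n : ℕ | y (n + 1) - y n ∉ Set.range (spectrumGaps β β' l j)}.Finite ∧
    ∀ k : Fin 3, HasFrequency (fun n => y (n + 1) - y n) (spectrumGaps β β' l j k)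
      (spectrumFrequencies β l j (s + t) k) := by
  have hb := h.one_lt
  obtain ⟨hP, hQ, hle⟩ := window_bounds hb hlow hup
  obtain ⟨u, w, hbasis, eu, ew, eu', ew'⟩ := h.exists_isWindowBasis hj hjβ hP hQ hle
  have hmain := hbasis.hasFrequency_gap (h.isModelSet hσ hs ht hst hfull l) hy
    (fun n => by
      obtain ⟨v, hv, -⟩ := h.exists_of_mem_digitSpectrum hσ hs ht (hyX n)
      exact ⟨v, by rw [Set.mem_ofPred_eq, hv]; exact hyX n, hv⟩)
    (fun v hv hle => hXy _ hv hle) htop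
  have eg : ∀ v, ((AddMonoidHom.mulLeft ((ε : ℝ) ^ l)).comp (latticeValue β')) v =
      (ε : ℝ) ^ l * latticeValue β' v := fun v => rfl
  have egaps : ![latticeValue β u, latticeValue β w, latticeValue β u + latticeValue β w] =
      spectrumGaps β β' l j := by
    rw [eu, ew, spectrumGaps]
    congr 3
    ring
  have h1 : 0 < β - 1 := by linarith
  have h2 : 0 < β := by linarith
  have hN : (0 : ℝ) < s + t := by exact_mod_cast hst
  have e : β ^ ((l : ℤ) - 1) = β ^ l / β := by
    rw [zpow_sub_one₀ h2.ne', zpow_natCast, div_eq_mul_inv]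
  have eR : 2 * windowRadius β s t = (s + t) * (β / (β - 1)) := by
    rw [windowRadius]; field_simp
  have efreq : ![1 - β ^ l / (2 * windowRadius β s t),
      1 + -(β ^ l * (β - j)) / (2 * windowRadius β s t),
      (β ^ l - -(β ^ l * (β - j))) / (2 * windowRadius β s t) - 1] =
      spectrumFrequencies β l j (s + t) := by
    rw [spectrumFrequencies, eR, e]
    ext k
    fin_cases k
    · simp; field_simp
    · simp; field_simp; ring
    · simp; field_simp; ring
  rw [eg, eg, eu', ew', efreq, egaps] at hmain
  exact hmain

/-- Without exceptional gaps in the two-sided case. -/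
theorem gap_mem_range_spectrumGaps (h : IsQuadraticUnitPair β β' m ε) (hσ : σ = 1 ∨ σ = -1)
    (hs : 0 ≤ s) (ht : 0 ≤ t) (hst : β < s + t + 1) (hcase : σ = -1 ∨ (1 ≤ s ∧ 1 ≤ t))
    (hj : 1 ≤ j) (hjβ : j < β)
    (hlow : β ^ ((l : ℤ) - 1) * (β - 1) * max (β - (j : ℝ)) 1 < s + t)
    (hup : (s : ℝ) + t ≤ β ^ ((l : ℤ) - 1) * (β - 1) * (β - (j : ℝ) + 1))
    {x x' : ℝ} (hx : x ∈ digitSpectrum (Finset.Icc (-s) t) (σ * β))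
    (hx' : x' ∈ digitSpectrum (Finset.Icc (-s) t) (σ * β)) (hlt : x < x')
    (hcons : ∀ z ∈ digitSpectrum (Finset.Icc (-s) t) (σ * β), x < z → x' ≤ z) :
    x' - x ∈ Set.range (spectrumGaps β β' l j) := by
  have hb := h.one_lt
  have hst' : 0 < s + t := by
    have : (0 : ℝ) < s + t := by linarith
    exact_mod_cast this
  obtain ⟨hP, hQ, hle⟩ := window_bounds hb hlow hup
  obtain ⟨u, w, hbasis, eu, ew, eu', ew'⟩ := h.exists_isWindowBasis hj hjβ hP hQ hle
  have eg : ∀ v, ((AddMonoidHom.mulLeft ((ε : ℝ) ^ l)).comp (latticeValue β')) v =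
      (ε : ℝ) ^ l * latticeValue β' v := fun v => rfl
  have habs : |(ε : ℝ) ^ l| = 1 := by
    rw [abs_pow]
    rcases h.sign with h1 | h1 <;> simp [h1]
  have hmodel := h.isModelSet hσ hs ht hst' (fun δ hδ => ⟨0, fun v _ hv =>
    h.mem_digitSpectrum_of_twoSided hσ hs ht hst hcase (by linarith)⟩) l
  obtain ⟨v, rfl, -⟩ := h.exists_of_mem_digitSpectrum hσ hs ht hx
  obtain ⟨v', rfl, -⟩ := h.exists_of_mem_digitSpectrum hσ hs ht hx'
  set R := windowRadius β s t with hR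
  set P := β ^ l with hPdef
  set Q := β ^ l * (β - j) with hQdef
  have hP0 : 0 < P := by positivity
  have hQ0 : 0 < Q := mul_pos hP0 (by linarith)
  -- In the two-sided case membership holds in the whole open window without a threshold, so any
  -- margin small enough for `IsWindowBasis.gap` will do and no gap is exceptional.
  set δ := min (min (2 * R - P) (2 * R - Q)) (min P Q) / 4 with hδ
  have hmin : 0 < min (min (2 * R - P) (2 * R - Q)) (min P Q) := by
    simp only [lt_min_iff]
    exact ⟨⟨by linarith, by linarith⟩, hP0, hQ0⟩
  have a1 := min_le_left (min (2 * R - P) (2 * R - Q)) (min P Q)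
  have a2 := min_le_right (min (2 * R - P) (2 * R - Q)) (min P Q)
  have a3 := min_le_left (2 * R - P) (2 * R - Q)
  have a4 := min_le_right (2 * R - P) (2 * R - Q)
  have a5 := min_le_left P Q
  have a6 := min_le_right P Q
  have hgap := (hbasis.gap (δ := δ) (by linarith) (by rw [eg, eu']; linarith)
    (by rw [eg, ew']; linarith) (by rw [eg, eu']; linarith) (by rw [eg, ew']; linarith)
    hmodel.bound hmodel.diff (v := v) (v' := v') (by
      intro x _ hx
      rw [eg, ← mul_sub, abs_mul, habs, one_mul] at hx
      exact h.mem_digitSpectrum_of_twoSided hσ hs ht hst hcase (by linarith))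
    hx hx' hlt (fun x hx => hcons _ hx)).1
  rcases hgap with h' | h' | h'
  · exact ⟨0, by rw [h', eu]; rfl⟩
  · exact ⟨1, by rw [h', ew]; rfl⟩
  · refine ⟨2, ?_⟩
    rw [h', eu, ew]
    change 1 / β ^ l * ((j : ℝ) + 1 - β') = _
    ring

theorem finite_digitSpectrum_inter_Icc (h : IsQuadraticUnitPair β β' m ε) (hσ : σ = 1 ∨ σ = -1)
    (hs : 0 ≤ s) (ht : 0 ≤ t) (a b : ℝ) :
    (digitSpectrum (Finset.Icc (-s) t) (σ * β) ∩ Set.Icc a b).Finite := by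
  refine ((h.finite_bounded (|a| + |b|)
    (windowRadius β s t + |windowCenter (σ * β') s t|)).image (latticeValue β)).subset ?_
  rintro x ⟨hx, hxa, hxb⟩
  obtain ⟨v, rfl, hv⟩ := h.exists_of_mem_digitSpectrum hσ hs ht hx
  refine ⟨v, ⟨?_, ?_⟩, rfl⟩
  · rw [abs_le]
    have := neg_abs_le a
    have := le_abs_self b
    have := abs_nonneg a
    have := abs_nonneg b
    constructor <;> linarith
  · have := abs_add_le (latticeValue β' v - windowCenter (σ * β') s t) (windowCenter (σ * β') s t)
    rw [sub_add_cancel] at this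
    linarith

end IsQuadraticUnitPair

section Unbounded

variable {A : Finset ℤ} {α : ℝ}

/-- Prefixing two zero digits multiplies by `α ^ 2`, which keeps the sign of `x` even for a negative
base. -/
theorem exists_lt_mem_digitSpectrum (h0 : (0 : ℤ) ∈ A) (hα : 1 < α ^ 2) {x : ℝ}
    (hx : x ∈ digitSpectrum A α) (hpos : 0 < x) (B : ℝ) : ∃ y ∈ digitSpectrum A α, B < y := by
  have hmem : ∀ n : ℕ, (α ^ 2) ^ n * x ∈ digitSpectrum A α := by
    intro n
    induction n with
    | zero => simpa using hx
    | succ n ih =>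
      have := add_mul_mem_digitSpectrum h0 (add_mul_mem_digitSpectrum h0 ih)
      convert this using 1
      push_cast; ring
  obtain ⟨n, hn⟩ := pow_unbounded_of_one_lt (B / x) hα
  exact ⟨_, hmem n, by rwa [div_lt_iff₀ hpos] at hn⟩

theorem exists_mem_digitSpectrum_lt (h0 : (0 : ℤ) ∈ A) (hα : 1 < α ^ 2) {x : ℝ}
    (hx : x ∈ digitSpectrum A α) (hneg : x < 0) (B : ℝ) : ∃ y ∈ digitSpectrum A α, y < B := by
  have hmem : ∀ n : ℕ, (α ^ 2) ^ n * x ∈ digitSpectrum A α := by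
    intro n
    induction n with
    | zero => simpa using hx
    | succ n ih =>
      have := add_mul_mem_digitSpectrum h0 (add_mul_mem_digitSpectrum h0 ih)
      convert this using 1
      push_cast; ring
  obtain ⟨n, hn⟩ := pow_unbounded_of_one_lt (B / x) hα
  exact ⟨_, hmem n, by rwa [div_lt_iff_of_neg hneg] at hn⟩

theorem tendsto_atTop_of_strictMono_of_unbounded {y : ℕ → ℝ} (hy : StrictMono y)
    (h : ∀ B, ∃ n, B < y n) : Tendsto y atTop atTop :=
  tendsto_atTop_atTop.2 fun B => by
    obtain ⟨n, hn⟩ := h B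
    exact ⟨n, fun k hk => hn.le.trans (hy.monotone hk)⟩

end Unbounded

/-! ### Enumeration of the spectrum and the final statement. -/

namespace IsQuadraticUnitPair

variable {β β' : ℝ} {m ε σ s t : ℤ} {l j : ℕ}

theorem exists_enumeration_oneSided (h : IsQuadraticUnitPair β β' m ε)
    (ht : 0 ≤ t) (hst : β < t + 1) (hj : 1 ≤ j) (hjβ : j < β)
    (hlow : β ^ ((l : ℤ) - 1) * (β - 1) * max (β - (j : ℝ)) 1 < t)
    (hup : (t : ℝ) ≤ β ^ ((l : ℤ) - 1) * (β - 1) * (β - (j : ℝ) + 1)) :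
    ∃ y : ℕ → ℝ, StrictMono y ∧ Set.range y = digitSpectrum (Finset.Icc 0 t) β ∧
      {n : ℕ | y (n + 1) - y n ∉ Set.range (spectrumGaps β β' l j)}.Finite ∧
      ∀ k : Fin 3, HasFrequency (fun n => y (n + 1) - y n) (spectrumGaps β β' l j k)
        (spectrumFrequencies β l j t k) := by
  have hb := h.one_lt
  have ht0 : 0 < t := by
    have : (0 : ℝ) < t := by linarith
    exact_mod_cast this
  have h0 : (0 : ℤ) ∈ Finset.Icc 0 t := Finset.mem_Icc.2 ⟨le_rfl, ht⟩
  have h1 : (1 : ℝ) ∈ digitSpectrum (Finset.Icc 0 t) β := by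
    have := intCast_mem_digitSpectrum (α := β) h0 (a := 1)
      (Finset.mem_Icc.2 ⟨by norm_num, by omega⟩)
    simpa using this
  have hup' := exists_lt_mem_digitSpectrum h0 (by nlinarith : 1 < β ^ 2) h1 one_pos
  have hnonneg : ∀ x ∈ digitSpectrum (Finset.Icc 0 t) β, 0 ≤ x := by
    intro x hx
    refine digitSpectrum_induction (P := fun x => 0 ≤ x) le_rfl (fun a ha x hx => ?_) hx
    have : (0 : ℝ) ≤ a := by exact_mod_cast (Finset.mem_Icc.1 ha).1
    have : 0 ≤ β * x := mul_nonneg (by linarith) hx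
    linarith
  have hfin := h.finite_digitSpectrum_inter_Icc (σ := 1) (s := 0) (Or.inl rfl) le_rfl ht
  simp only [neg_zero, Int.cast_one, one_mul] at hfin
  obtain ⟨y, hy, hyX⟩ := exists_strictMono_nat_range_eq hfin hup'
    (zero_mem_digitSpectrum h0) hnonneg
  have hmem : ∀ n, y n ∈ digitSpectrum (Finset.Icc 0 t) β := fun n => hyX ▸ Set.mem_range_self n
  have hex : ∀ x ∈ digitSpectrum (Finset.Icc 0 t) β, ∃ n, y n = x := fun x hx => by
    rw [← hyX] at hx; exact hx
  have hmain := h.hasFrequency_spectrum (σ := 1) (s := 0) (l := l) (j := j) (y := y) (Or.inl rfl)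
    le_rfl ht (by omega) hj hjβ (by simpa using hlow) (by simpa using hup)
    (fun δ hδ => by simpa using h.mem_digitSpectrum_of_oneSided ht hst hδ) hy
    (by simpa using hmem) (fun x hx _ => hex x (by simpa using hx))
    (tendsto_atTop_of_strictMono_of_unbounded hy fun B => by
      obtain ⟨x, hx, hlt⟩ := hup' B
      obtain ⟨n, rfl⟩ := hex x hx
      exact ⟨n, hlt⟩)
  rw [Int.cast_zero, zero_add] at hmain
  exact ⟨y, hy, hyX, hmain⟩

theorem exists_enumeration_twoSided (h : IsQuadraticUnitPair β β' m ε) (hσ : σ = 1 ∨ σ = -1)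
    (hs : 0 ≤ s) (ht : 0 ≤ t) (hst : β < s + t + 1) (hcase : σ = -1 ∨ (1 ≤ s ∧ 1 ≤ t))
    (hj : 1 ≤ j) (hjβ : j < β)
    (hlow : β ^ ((l : ℤ) - 1) * (β - 1) * max (β - (j : ℝ)) 1 < s + t)
    (hup : (s : ℝ) + t ≤ β ^ ((l : ℤ) - 1) * (β - 1) * (β - (j : ℝ) + 1)) :
    ∃ y : ℤ → ℝ, StrictMono y ∧ Set.range y = digitSpectrum (Finset.Icc (-s) t) (σ * β) ∧
      (∀ n : ℤ, y (n + 1) - y n ∈ Set.range (spectrumGaps β β' l j)) ∧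
      ∀ k : Fin 3, HasTwoSidedFrequency (fun n : ℤ => y (n + 1) - y n)
        (spectrumGaps β β' l j k) (spectrumFrequencies β l j (s + t) k) := by
  have hb := h.one_lt
  have hst' : 0 < s + t := by
    have : (0 : ℝ) < s + t := by linarith
    exact_mod_cast this
  have h0 : (0 : ℤ) ∈ Finset.Icc (-s) t := Finset.mem_Icc.2 ⟨by omega, ht⟩
  have hα : 1 < ((σ : ℝ) * β) ^ 2 := by
    have : ((σ : ℝ) * β) ^ 2 = β ^ 2 := by rcases hσ with rfl | rfl <;> simp
    rw [this]; nlinarith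
  obtain ⟨⟨x₁, hx₁, hpos⟩, ⟨x₂, hx₂, hneg⟩⟩ :
      (∃ x ∈ digitSpectrum (Finset.Icc (-s) t) (σ * β), 0 < x) ∧
      (∃ x ∈ digitSpectrum (Finset.Icc (-s) t) (σ * β), x < 0) := by
    have hone : 1 ≤ t → (1 : ℝ) ∈ digitSpectrum (Finset.Icc (-s) t) (σ * β) := fun h1 => by
      have := intCast_mem_digitSpectrum (α := σ * β) h0 (a := 1)
        (Finset.mem_Icc.2 ⟨by omega, h1⟩)
      simpa using this
    have hmone : 1 ≤ s → (-1 : ℝ) ∈ digitSpectrum (Finset.Icc (-s) t) (σ * β) := fun h1 => by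
      have := intCast_mem_digitSpectrum (α := σ * β) h0 (a := -1)
        (Finset.mem_Icc.2 ⟨by omega, by omega⟩)
      simpa using this
    by_cases h12 : 1 ≤ s ∧ 1 ≤ t
    · exact ⟨⟨1, hone h12.2, one_pos⟩, ⟨-1, hmone h12.1, by norm_num⟩⟩
    · obtain rfl := hcase.resolve_right h12
      by_cases h1 : 1 ≤ t
      · refine ⟨⟨1, hone h1, one_pos⟩, ⟨_, add_mul_mem_digitSpectrum h0 (hone h1), ?_⟩⟩
        push_cast; linarith
      · have h2 : 1 ≤ s := by omega
        refine ⟨⟨_, add_mul_mem_digitSpectrum h0 (hmone h2), ?_⟩, ⟨-1, hmone h2, by norm_num⟩⟩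
        push_cast; linarith
  have hupX := exists_lt_mem_digitSpectrum h0 hα hx₁ hpos
  have hdownX := exists_mem_digitSpectrum_lt h0 hα hx₂ hneg
  obtain ⟨y, hy, hyX⟩ := exists_strictMono_int_range_eq
    (h.finite_digitSpectrum_inter_Icc hσ hs ht) hupX hdownX
  have hmem : ∀ n, y n ∈ digitSpectrum (Finset.Icc (-s) t) (σ * β) :=
    fun n => hyX ▸ Set.mem_range_self n
  have hex : ∀ x ∈ digitSpectrum (Finset.Icc (-s) t) (σ * β), ∃ n, y n = x := fun x hx => by
    rw [← hyX] at hx; exact hx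
  have hyn : StrictMono fun n : ℕ => y n := fun a b hab => hy (by exact_mod_cast hab)
  have hyn' : StrictMono fun n : ℕ => -y (-n) := fun a b hab => by
    have : y (-b) < y (-a) := hy (by omega)
    exact neg_lt_neg this
  have hright := h.hasFrequency_spectrum (l := l) (j := j) (y := fun n : ℕ => y n) hσ hs ht hst'
    hj hjβ hlow hup
    (fun δ hδ => ⟨0, fun v _ hv =>
      h.mem_digitSpectrum_of_twoSided hσ hs ht hst hcase (by linarith)⟩) hyn
    (fun n => hmem n)
    (fun x hx hle => by
      obtain ⟨n, rfl⟩ := hex x hx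
      have hn : 0 ≤ n := by simpa using hy.le_iff_le.1 hle
      exact ⟨n.toNat, by rw [Int.toNat_of_nonneg hn]⟩)
    (tendsto_atTop_of_strictMono_of_unbounded hyn fun B => by
      obtain ⟨x, hx, hlt⟩ := hupX B
      obtain ⟨n, rfl⟩ := hex x hx
      exact ⟨n.toNat, hlt.trans_le (hy.monotone (Int.self_le_toNat n))⟩)
  -- The left half, reflected to `n ↦ -y (-n)`, enumerates upward a part of the spectrum of the
  -- negated digits, which has the same gaps and the same `s + t`.
  have hleft := h.hasFrequency_spectrum (s := t) (t := s) (l := l) (j := j)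
    (y := fun n : ℕ => -y (-n)) hσ ht hs (by omega)
    hj hjβ (by rw [add_comm]; exact hlow) (by rw [add_comm]; exact hup)
    (fun δ hδ => ⟨0, fun v _ hv =>
      h.mem_digitSpectrum_of_twoSided hσ ht hs (by linarith) (hcase.imp_right And.symm)
        (by linarith)⟩) hyn'
    (fun n => neg_mem_digitSpectrum (hmem _))
    (fun x hx hle => by
      obtain ⟨n, hn⟩ := hex (-x) (neg_mem_digitSpectrum hx)
      have hle' : y n ≤ y 0 := by
        rw [hn]
        simp only [Nat.cast_zero, neg_zero] at hle
        linarith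
      have hn0 : n ≤ 0 := hy.le_iff_le.1 hle'
      refine ⟨(-n).toNat, ?_⟩
      rw [Int.toNat_of_nonneg (by omega), neg_neg, hn, neg_neg])
    (tendsto_atTop_of_strictMono_of_unbounded hyn' fun B => by
      obtain ⟨x, hx, hlt⟩ := hdownX (-B)
      obtain ⟨n, rfl⟩ := hex x hx
      refine ⟨(-n).toNat, ?_⟩
      have : y (-((-n).toNat : ℤ)) ≤ y n := hy.monotone (by omega)
      linarith)
  refine ⟨y, hy, hyX, ?_, ?_⟩
  · intro n
    refine h.gap_mem_range_spectrumGaps hσ hs ht hst hcase hj hjβ hlow hup (hmem n) (hmem (n + 1))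
      (hy (by omega)) ?_
    intro z hz hlt
    obtain ⟨k, rfl⟩ := hex z hz
    exact hy.monotone (by have := hy.lt_iff_lt.1 hlt; omega)
  · intro k
    refine ⟨?_, ?_⟩
    · have := hright.2 k
      simpa using this
    · have := hleft.2 k
      rw [add_comm (t : ℝ)] at this
      convert this using 2 with n
      -- The gap with index `-1 - n` runs from `y (-(n + 1))` to `y (-n)`, which is gap `n` of the
      -- reflected sequence.
      have e1 : (-1 - (n : ℤ) + 1) = -(n : ℤ) := by ring
      have e2 : (-1 - (n : ℤ)) = -((n + 1 : ℕ) : ℤ) := by push_cast; ring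
      dsimp only
      rw [e1, e2]
      ring

end IsQuadraticUnitPair

theorem mainTheorem3
    (β β' : ℝ) (hβ : IsQuadraticPisotUnit β)
    (hβ' : IsConjRoot ℚ β β') (hne : β' ≠ β)
    (A : Finset ℤ) (hA : ∃ a b : ℤ, A = Finset.Icc a b) (h0 : (0 : ℤ) ∈ A)
    (hcard : β < (A.card : ℝ))
    (l j : ℕ) (hj1 : 1 ≤ j) (hj2 : j ≤ ⌊β⌋₊)
    (hlow : β ^ ((l : ℤ) - 1) * (β - 1) * max (β - (j : ℝ)) 1 < (A.card : ℝ) - 1)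
    (hup : (A.card : ℝ) - 1 ≤ β ^ ((l : ℤ) - 1) * (β - 1) * (β - (j : ℝ) + 1))
    (Δ ρ : Fin 3 → ℝ)
    (hΔ : Δ = ![1 / β ^ l, 1 / β ^ l * ((j : ℝ) - β'), 1 / β ^ l * ((j : ℝ) + 1 - β')])
    (hρ : ρ = ![1 - β ^ ((l : ℤ) - 1) * (β - 1) / ((A.card : ℝ) - 1),
      1 - β ^ ((l : ℤ) - 1) * (β - (j : ℝ)) * (β - 1) / ((A.card : ℝ) - 1),
      -1 + β ^ ((l : ℤ) - 1) * (β - (j : ℝ) + 1) * (β - 1) / ((A.card : ℝ) - 1)])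
    (α : ℝ) (hα : α = β ∨ α = -β) :
    -- base `β`, no negative digits: the spectrum is a sequence increasing from its minimum
    (α = β → (-1 : ℤ) ∉ A →
      ∃ y : ℕ → ℝ, StrictMono y ∧ Set.range y = digitSpectrum A α ∧
        {n : ℕ | y (n + 1) - y n ∉ Set.range Δ}.Finite ∧
        ∀ k : Fin 3, HasFrequency (fun n : ℕ => y (n + 1) - y n) (Δ k) (ρ k)) ∧
    -- base `β`, no positive digits: the spectrum is a sequence decreasing from its maximum
    (α = β → (1 : ℤ) ∉ A →
      ∃ y : ℕ → ℝ, StrictAnti y ∧ Set.range y = digitSpectrum A α ∧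
        {n : ℕ | y n - y (n + 1) ∉ Set.range Δ}.Finite ∧
        ∀ k : Fin 3, HasFrequency (fun n : ℕ => y n - y (n + 1)) (Δ k) (ρ k)) ∧
    -- all other cases: the spectrum is a bidirectional sequence, and there are no exceptional gaps
    (α = -β ∨ ((-1 : ℤ) ∈ A ∧ (1 : ℤ) ∈ A) →
      ∃ y : ℤ → ℝ, StrictMono y ∧ Set.range y = digitSpectrum A α ∧
        (∀ n : ℤ, y (n + 1) - y n ∈ Set.range Δ) ∧
        ∀ k : Fin 3, HasTwoSidedFrequency (fun n : ℤ => y (n + 1) - y n) (Δ k) (ρ k)) := by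

  obtain ⟨m, ε, h⟩ := hβ.exists_isQuadraticUnitPair hβ' hne
  obtain ⟨a, b, rfl⟩ := hA
  obtain ⟨ha, hb⟩ := Finset.mem_Icc.1 h0
  obtain ⟨s, rfl⟩ : ∃ s, a = -s := ⟨-a, by ring⟩
  have hs : 0 ≤ s := by omega
  have hc : (((Finset.Icc (-s) b).card : ℕ) : ℝ) = s + b + 1 := by
    rw [Int.card_Icc]
    have h1 : (((b + 1 - -s).toNat : ℤ) : ℝ) = ((b + 1 - -s : ℤ) : ℝ) := by
      rw [Int.toNat_of_nonneg (by omega)]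
    rw [Int.cast_natCast] at h1
    rw [h1]; push_cast; ring
  rw [hc] at hcard hlow hup hρ
  rw [add_sub_cancel_right] at hlow hup hρ
  -- Irrationality of `β` makes `j ≤ β` strict, so that the conjugate of `w` does not vanish.
  have hjβ : (j : ℝ) < β := by
    have h1 : (j : ℝ) ≤ β := (Nat.le_floor_iff (by linarith [h.one_lt])).1 hj2
    exact h1.lt_of_ne fun heq => h.irrational ⟨j, by rw [← heq]; simp⟩
  have hΔ' : Δ = IsQuadraticUnitPair.spectrumGaps β β' l j := hΔ
  have hρ' : ρ = IsQuadraticUnitPair.spectrumFrequencies β l j (s + b) := hρ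
  subst hΔ' hρ'
  refine ⟨?_, ?_, ?_⟩
  · rintro rfl hm1
    have hs0 : s = 0 := by
      rw [Finset.mem_Icc] at hm1; omega
    subst hs0
    rw [Int.cast_zero, zero_add] at hcard hlow hup ⊢
    rw [neg_zero]
    exact h.exists_enumeration_oneSided hb hcard hj1 hjβ hlow hup
  · rintro rfl hm1
    have hb0 : b = 0 := by
      rw [Finset.mem_Icc] at hm1; omega
    subst hb0
    rw [Int.cast_zero, add_zero] at hcard hlow hup ⊢
    -- The spectrum of nonpositive digits is the negative of the spectrum of the digits from `0` to
    -- `s`.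
    obtain ⟨y, hy, hyX, hgap, hfreq⟩ :=
      h.exists_enumeration_oneSided hs hcard hj1 hjβ hlow hup
    have e : ∀ n, -y n - -y (n + 1) = y (n + 1) - y n := fun n => by ring
    refine ⟨fun n => -y n, hy.neg, ?_, ?_, ?_⟩
    · ext x
      have h1 := neg_mem_digitSpectrum_iff (s := s) (t := 0) (x := x) (α := α)
      rw [neg_zero] at h1
      rw [← h1, ← hyX]
      simp only [Set.mem_range, neg_eq_iff_eq_neg]
    · simpa only [e] using hgap
    · simpa only [e] using hfreq
  · intro hcase
    obtain ⟨σ, hσ, rfl, hcase'⟩ : ∃ σ : ℤ, (σ = 1 ∨ σ = -1) ∧ α = σ * β ∧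
        (σ = -1 ∨ (1 ≤ s ∧ 1 ≤ b)) := by
      rcases hα with rfl | rfl
      · refine ⟨1, Or.inl rfl, by simp, Or.inr ?_⟩
        rcases hcase with h1 | ⟨h1, h2⟩
        · linarith [h.one_lt]
        · rw [Finset.mem_Icc] at h1 h2; omega
      · exact ⟨-1, Or.inr rfl, by simp, Or.inl rfl⟩
    exact h.exists_enumeration_twoSided hσ hs hb hcard hcase' hj1 hjβ hlow hup
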